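/- **Setting.** There are $n\ge1$ agents. The decision set $\mathbb X\subseteq\mathbb R^p$ is closed and convex with $\|x\|\le R$ on $\mathbb X$. For $i\in[n]$ and $t=1,2,\dots$ the losses $f_{i,t}:\mathbb X\to\mathbb R$ and the components of the constraint functions $g_{i,t}:\mathbb X\to\mathbb R^{m_i}$ are convex, with $|f_{i,t}(x)-f_{i,t}(y)|\le F_1$ and $\|g_{i,t}(x)\|\le F_1$ for $x,y\in\mathbb X$. At every $x\in\mathbb X$ there are given subgradients $\partial f_{i,t}(x)\in\mathbb R^p$ and $\partial g_{i,t}(x)\in\mathbb R^{p\times m_i}$ (column by column), with $\|\partial f_{i,t}(x)\|\le F_2$ and $\|\partial g_{i,t}(x)\|\le F_2$. Here $R,F_1,F_2>0$. Put $f_t=\frac1n\sum_j f_{j,t}$ and $g_t=\mathrm{col}(g_{1,t},\dots,g_{n,t})$. **Network.** Let $\mathcal G_t=([n],\mathcal E_t)$, $t\ge1$, be directed graphs and $W_t\in\mathbb R^{n\times n}$ mixing matrices with $[W_t]_{ij}>0$ if $(j,i)\in\mathcal E_t$ or $i=j$, and $[W_t]_{ij}=0$ otherwise. Every $W_t$ is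 doubly stochastic, its positive entries are at least $w\in(0,1)$, and for some integer $B>0$ and all $t\ge1$ the graph $([n],\bigcup_{l=0}^{B-1}\mathcal E_{t+l})$ is strongly connected. **Thresholds.** $\tau_t\ge0$ for $t\ge1$, $\tau_{t+1}\le\tau_t$ for $t\ge2$, and $\tau_1>0$. Let $\Psi_t=\sum_{s=1}^t\tau_s$, $\kappa\in(0,1)$, $\alpha_t=\sqrt{\Psi_t/t}$, $\beta_t=t^{-\kappa}$, $\gamma_t=t^{\kappa-1}$. **Algorithm.** Start from any $x_{i,1}\in\mathbb X$, $\hat x_{i,1}=x_{i,1}$, $q_{i,1}=0$. For $t\ge1$ and all $i$, let $$z_{i,t+1}=\sum_j[W_t]_{ij}\hat x_{j,t},\qquad \omega_{i,t+1}=\partial f_{i,t}(x_{i,t})+\partial[g_{i,t}(x_{i,t})]_+\,q_{i,t},\qquad x_{i,t+1}=\mathcal P_{\mathbb X}(z_{i,t+1}-\alpha_{t+1}\omega_{i,t+1}),$$ $$q_{i,t+1}=\Big[(1-\beta_{t+1}\gamma_{t+1})q_{i,t}+\gamma_{t+1}\big([g_{i,t}(x_{i,t})]_++(\partial[g_{i,t}(x_{i,t})]_+)^T(x_{i,t+1}-x_{i,t})\big)\Big]_+,$$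 and $\hat x_{i,t+1}=x_{i,t+1}$ if $\|x_{i,t+1}-\hat x_{i,t}\|\ge\tau_{t+1}$, $\hat x_{i,t+1}=\hat x_{i,t}$ otherwise. Here $[\cdot]_+$ is the componentwise positive part, $\mathcal P_{\mathbb X}$ the Euclidean projection, and $\partial[g_{i,t}(x)]_+$ is a (column by column) subgradient of $[g_{i,t}]_+$ at $x$ on $\mathbb X$ each of whose columns is the corresponding column of $\partial g_{i,t}(x)$ times a factor in $[0,1]$. **Theorem.** There is a constant $C>0$, depending only on $n$, $m_1,\dots,m_n$, $R$, $F_1$, $F_2$, $w$, $B$, $\kappa$ and the sequence $(\tau_t)$, such that for every such problem, network and run of the algorithm, and every $T\ge1$ for which some $x\in\mathbb X$ satisfies $g_t(x)\le0$ for all $t\in[T]$: 1. for every comparator sequence $y_1,\dots,y_T\in\mathbb X$ with $g_t(y_t)\le0$ for all $t\in[T]$, with $P_T=\sum_{t=1}^{T-1}\|y_{t+1}-y_t\|$, $$\frac1n\sum_{i=1}^n\sum_{t=1}^Tf_t(x_{i,t})-\sum_{t=1}^Tf_t(y_t)\le C\Big(T^\kappa+\sqrt{\Psi_TT}+\sqrt{\Psi_T^{-1}T}\,P_T\Big);$$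 2. $$\frac1n\sum_{i=1}^n\sum_{t=1}^T\big\|[g_t(x_{i,t})]_+\big\|\le C\Big(T^{1-\kappa/2}+\sqrt[4]{\Psi_TT^3}\Big).$$ -/

import Mathlib

noncomputable section

namespace EventTriggered

/-- Euclidean space `ℝ^p`. -/
abbrev E (p : ℕ) : Type := EuclideanSpace ℝ (Fin p)

/-- The projection `[v]_+` of a vector onto the nonnegative orthant (componentwise `max · 0`). -/
def plus {ι : Type} (v : EuclideanSpace ℝ ι) : EuclideanSpace ℝ ι :=
  WithLp.toLp 2 fun k => max (v k) 0

/-- `y` is a nearest point of `X` to `v`, i.e. `y = P_X(v)`. -/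
def IsProjection {p : ℕ} (X : Set (E p)) (v y : E p) : Prop :=
  y ∈ X ∧ ∀ u ∈ X, ‖v - y‖ ≤ ‖v - u‖

/-- `s` is a subgradient at `x` of the real function `h` on `X`. -/
def IsSubgradient {p : ℕ} (X : Set (E p)) (h : E p → ℝ) (x s : E p) : Prop :=
  ∀ y ∈ X, h x + inner ℝ s (y - x) ≤ h y

/-- `D` is the transpose of a `p × r` subgradient matrix at `x` of the vector function `h` on `X`:
the `k`-th component of `D` is (the inner product with) a subgradient of the `k`-th component
of `h`. -/
def IsVectorSubgradient {p r : ℕ} (X : Set (E p)) (h : E p → E r) (x : E p)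
    (D : E p →L[ℝ] E r) : Prop :=
  ∀ y ∈ X, ∀ k, h x k + D (y - x) k ≤ h y k

/-- `D'` is (the transpose of) a subgradient matrix at `x` of the vector function `[h]_+` on `X`
which comes from the subgradient matrix `D` of `h`: each column of the matrix is the matching
column for `h` times a factor in `[0,1]`. (Factor `1` where `h x k > 0`, factor `0` where
`h x k < 0` and any factor in `[0,1]` where `h x k = 0` always gives such a subgradient.) -/
def IsPlusSubgradient {p r : ℕ} (X : Set (E p)) (h : E p → E r) (x : E p)
    (D D' : E p →L[ℝ] E r) : Prop :=
  IsVectorSubgradient X (fun y => plus (h y)) x D' ∧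
    ∀ k, ∃ θ : ℝ, 0 ≤ θ ∧ θ ≤ 1 ∧ ∀ v, D' v k = θ * D v k

/-- Data of an online problem with `n` agents in `ℝ^p`: decision set, local losses `f i t`,
local constraint functions `g i t` with values in `ℝ^(m i)`, and the subgradients of these that
the agents are given (`dg i t x` is the transpose of the `p × m i` subgradient matrix). Rounds are
`t = 1, 2, …`, and only values at points of `X` matter. -/
structure Problem (n p : ℕ) (m : Fin n → ℕ) where
  X : Set (E p)
  f : Fin n → ℕ → E p → ℝ
  g : (i : Fin n) → ℕ → E p → E (m i)
  df : Fin n → ℕ → E p → E p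
  dg : (i : Fin n) → ℕ → E p → (E p →L[ℝ] E (m i))

/-- A time-varying directed graph on the agents with mixing matrices; `(graph t).Adj j i` says
that `i` can receive from `j` in round `t`. -/
structure Network (n : ℕ) where
  graph : ℕ → Digraph (Fin n)
  W : ℕ → Matrix (Fin n) (Fin n) ℝ

section Problem

variable {n p : ℕ} {m : Fin n → ℕ}

/-- The global loss `f_t = (1/n) ∑_j f_{j,t}`. -/
def Problem.globalLoss (P : Problem n p m) (t : ℕ) (x : E p) : ℝ :=
  (1 / (n : ℝ)) * ∑ j, P.f j t x

/-- The global constraint function `g_t = col(g_{1,t}, …, g_{n,t})`. -/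
def Problem.globalConstraint (P : Problem n p m) (t : ℕ) (x : E p) :
    EuclideanSpace ℝ (Σ i : Fin n, Fin (m i)) :=
  WithLp.toLp 2 fun k => P.g k.1 t x k.2

/-- Feasible decision sequences over the horizon `T` (entries `1, …, T`). -/
def Problem.feasible (P : Problem n p m) (T : ℕ) : Set (ℕ → E p) :=
  {y | ∀ t ∈ Finset.Icc 1 T, y t ∈ P.X ∧ ∀ k, P.globalConstraint t (y t) k ≤ 0}

/-- Points that are feasible in each round `1, …, T`: the feasible static decisions. -/
def Problem.staticFeasible (P : Problem n p m) (T : ℕ) : Set (E p) :=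
  {y | (fun _ => y) ∈ P.feasible T ∧ y ∈ P.X}

/-- Boundedness and convexity assumptions, with constants `R`, `F₁`, `F₂`. -/
structure Problem.Regular (P : Problem n p m) (R F₁ F₂ : ℝ) : Prop where
  convex : Convex ℝ P.X
  closed : IsClosed P.X
  bounded : ∀ x ∈ P.X, ‖x‖ ≤ R
  loss_convex : ∀ i t, 1 ≤ t → ConvexOn ℝ P.X (P.f i t)
  constraint_convex : ∀ i t, 1 ≤ t → ∀ k, ConvexOn ℝ P.X (fun x => P.g i t x k)
  loss_bound : ∀ i t, 1 ≤ t → ∀ x ∈ P.X, ∀ y ∈ P.X, |P.f i t x - P.f i t y| ≤ F₁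
  constraint_bound : ∀ i t, 1 ≤ t → ∀ x ∈ P.X, ‖P.g i t x‖ ≤ F₁
  loss_subgradient : ∀ i t, 1 ≤ t → ∀ x ∈ P.X, IsSubgradient P.X (P.f i t) x (P.df i t x)
  constraint_subgradient : ∀ i t, 1 ≤ t → ∀ x ∈ P.X,
    IsVectorSubgradient P.X (P.g i t) x (P.dg i t x)
  loss_subgradient_bound : ∀ i t, 1 ≤ t → ∀ x ∈ P.X, ‖P.df i t x‖ ≤ F₂
  constraint_subgradient_bound : ∀ i t, 1 ≤ t → ∀ x ∈ P.X, ‖P.dg i t x‖ ≤ F₂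

/-- Network assumptions: the support of `W t` is the graph together with the diagonal, positive
weights are at least `w`, `W t` is doubly stochastic, and the union of any `B` consecutive graphs
is strongly connected. -/
structure Network.Regular (N : Network n) (w : ℝ) (B : ℕ) : Prop where
  weight_pos : ∀ t, 1 ≤ t → ∀ i j, ((N.graph t).Adj j i ∨ i = j) → 0 < N.W t i j
  weight_zero : ∀ t, 1 ≤ t → ∀ i j, ¬ ((N.graph t).Adj j i ∨ i = j) → N.W t i j = 0
  weight_ge : ∀ t, 1 ≤ t → ∀ i j, 0 < N.W t i j → w ≤ N.W t i j
  col_sum : ∀ t, 1 ≤ t → ∀ j, ∑ i, N.W t i j = 1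
  row_sum : ∀ t, 1 ≤ t → ∀ i, ∑ j, N.W t i j = 1
  connected : ∀ t, 1 ≤ t → ∀ i j,
    Relation.ReflTransGen (fun a b => ∃ l < B, (N.graph (t + l)).Adj a b) i j

/-- A run of the distributed event-triggered online primal-dual algorithm with parameter sequences
`α`, `β`, `γ` and thresholds `τ`: decisions `x`, last broadcast decisions `xhat`, dual variables `q`,
and the transposed subgradients `D i t` of `[g_{i,t}]_+` at `x i t` that are observed. -/
structure IsRun (P : Problem n p m) (N : Network n) (α β γ τ : ℕ → ℝ)
    (x xhat : Fin n → ℕ → E p) (q : (i : Fin n) → ℕ → E (m i))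
    (D : (i : Fin n) → ℕ → (E p →L[ℝ] E (m i))) : Prop where
  init_x : ∀ i, x i 1 ∈ P.X
  init_xhat : ∀ i, xhat i 1 = x i 1
  init_q : ∀ i, q i 1 = 0
  observe : ∀ i t, 1 ≤ t →
    IsPlusSubgradient P.X (P.g i t) (x i t) (P.dg i t (x i t)) (D i t)
  primal : ∀ i t, 1 ≤ t →
    let z : E p := ∑ j, N.W t i j • xhat j t
    let ω : E p := P.df i t (x i t) + ContinuousLinearMap.adjoint (D i t) (q i t)
    IsProjection P.X (z - α (t + 1) • ω) (x i (t + 1))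
  dual : ∀ i t, 1 ≤ t →
    q i (t + 1) = plus ((1 - β (t + 1) * γ (t + 1)) • q i t
      + γ (t + 1) • (plus (P.g i t (x i t)) + D i t (x i (t + 1) - x i t)))
  trigger : ∀ i t, 1 ≤ t → τ (t + 1) ≤ ‖x i (t + 1) - xhat i t‖ →
    xhat i (t + 1) = x i (t + 1)
  no_trigger : ∀ i t, 1 ≤ t → ‖x i (t + 1) - xhat i t‖ < τ (t + 1) →
    xhat i (t + 1) = xhat i t

/-- Network regret up to `T` against the benchmark `y`. -/
def Problem.netReg (P : Problem n p m) (x : Fin n → ℕ → E p) (y : ℕ → E p) (T : ℕ) : ℝ :=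
  (1 / (n : ℝ)) * ∑ i, ∑ t ∈ Finset.Icc 1 T, P.globalLoss t (x i t)
    - ∑ t ∈ Finset.Icc 1 T, P.globalLoss t (y t)

/-- Network cumulative constraint violation up to `T`. -/
def Problem.netCCV (P : Problem n p m) (x : Fin n → ℕ → E p) (T : ℕ) : ℝ :=
  (1 / (n : ℝ)) * ∑ i, ∑ t ∈ Finset.Icc 1 T, ‖plus (P.globalConstraint t (x i t))‖

end Problem

/-- The path length `∑_{t=1}^{T-1} ‖y_{t+1} - y_t‖`. -/
def pathLength {p : ℕ} (y : ℕ → E p) (T : ℕ) : ℝ :=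
  ∑ t ∈ Finset.Ico 1 T, ‖y (t + 1) - y t‖

/-- `Ψ_t = ∑_{s=1}^t τ_s`. -/
def cumThreshold (τ : ℕ → ℝ) (t : ℕ) : ℝ := ∑ s ∈ Finset.Icc 1 t, τ s

end EventTriggered

end

noncomputable section
namespace EventTriggered
open Finset

/-! The proof is a primal-dual energy estimate. In one round, convexity of the loss, the
obtuse-angle property of the projection and the expansion of ‖q_{i,t+1}‖² bound an agent's regret
for its own loss by three pieces (`IsRun.loss_sub_le`): the movement F₂‖x_{i,t} - x_{i,t+1}‖, a
difference of squared distances to the comparator over 2α_{t+1}, and a difference of squared dual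
norms over 2γ_{t+1} minus β_{t+1}‖q_{i,t}‖², up to O(γ_{t+1}). The coupling of primal and dual drops
out because q ≥ 0 and [g(y)]_+ = 0.

Summed over agents, double stochasticity and Jensen remove the mixing, triggering costs
O(τ_t/α_{t+1}), and the squared distances telescope up to the path length (`sum_primal_le`). The
choice of α makes both ∑α_{t+1} and ∑τ_t/α_{t+1} of order √(Ψ_T T). Increments of 1/γ are at most β,
so half of the dual regularization survives (`sum_dual_le`). Disagreement contracts over windows of
nB rounds, so its sum is controlled by the thresholds and the total length of the primal steps
(`sum_disagreement_le_totalStep`); AM-GM absorbs that length into the negative energy ∑‖x_{i,t+1} -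
z_{i,t+1}‖²/α_{t+1}.

`sum_loss_add_residual_le` keeps the unspent negative terms on the left as `residual`. For the
regret, they absorb the cost of evaluating f_j at x_i instead of x_j. For the violation, a static
feasible comparator and the bound F₁ on loss differences give a residual of order T (`residual_le`).
Unrolling the dual recursion bounds the violation by ‖q_{T+1}‖/γ_{T+1}, ∑β‖q‖ and the total
movement; Cauchy-Schwarz against the residual then produces T^{1-κ/2} and (Ψ_T T³)^{1/4}. -/

/-! ### Sums of powers compared by telescoping. -/

lemma sum_Icc_le_of_step {a b : ℕ → ℝ} (h0 : 0 ≤ b 0)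
    (h : ∀ t, a (t + 1) + b t ≤ b (t + 1)) (T : ℕ) : ∑ t ∈ Icc 1 T, a t ≤ b T := by
  induction T with
  | zero => simpa using h0
  | succ T ih =>
    rw [Finset.sum_Icc_succ_top (by omega)]
    linarith [h T]

/-- Bernoulli's inequality (1 - 1/s)^a ≤ 1 - a/s at s = t + 1, multiplied by s^a. -/
lemma rpow_sub_rpow_ge {a : ℝ} (ha : 0 < a) (ha1 : a ≤ 1) (t : ℕ) :
    a * (1 / ((t + 1 : ℕ) : ℝ) ^ (1 - a)) ≤ ((t + 1 : ℕ) : ℝ) ^ a - (t : ℝ) ^ a := by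
  have hs : (0 : ℝ) < ((t + 1 : ℕ) : ℝ) := by positivity
  have h1 : (1 + (-1 / ((t + 1 : ℕ) : ℝ))) ^ a ≤ 1 + a * (-1 / ((t + 1 : ℕ) : ℝ)) := by
    apply rpow_one_add_le_one_add_mul_self _ ha.le ha1
    rw [le_div_iff₀ hs]
    push_cast
    have : (0 : ℝ) ≤ t := by positivity
    linarith
  have h2 : (1 + (-1 / ((t + 1 : ℕ) : ℝ))) = (t : ℝ) / ((t + 1 : ℕ) : ℝ) := by
    push_cast
    field_simp
    ring
  rw [h2, Real.div_rpow (by positivity) hs.le, div_le_iff₀ (by positivity)] at h1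
  have h3 : ((t + 1 : ℕ) : ℝ) ^ (1 - a) = ((t + 1 : ℕ) : ℝ) / ((t + 1 : ℕ) : ℝ) ^ a := by
    rw [Real.rpow_sub hs, Real.rpow_one]
  have hp : 0 < ((t + 1 : ℕ) : ℝ) ^ a := by positivity
  rw [h3]
  have h4 : a * (1 / (((t + 1 : ℕ) : ℝ) / ((t + 1 : ℕ) : ℝ) ^ a))
      = a * (1 / ((t + 1 : ℕ) : ℝ)) * ((t + 1 : ℕ) : ℝ) ^ a := by
    field_simp
  rw [h4]
  have h5 : (1 + a * (-1 / ((t + 1 : ℕ) : ℝ))) * ((t + 1 : ℕ) : ℝ) ^ a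
    = ((t + 1 : ℕ) : ℝ) ^ a - a * (1 / ((t + 1 : ℕ) : ℝ)) * ((t + 1 : ℕ) : ℝ) ^ a := by ring
  linarith

lemma succ_rpow_le_two_mul {a : ℝ} (ha : 0 ≤ a) (ha1 : a ≤ 1) {T : ℕ} (hT : 1 ≤ T) :
    ((T + 1 : ℕ) : ℝ) ^ a ≤ 2 * (T : ℝ) ^ a := by
  have hT' : (1 : ℝ) ≤ T := by exact_mod_cast hT
  calc ((T + 1 : ℕ) : ℝ) ^ a ≤ (2 * (T : ℝ)) ^ a := by
        apply Real.rpow_le_rpow (by positivity) _ ha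
        push_cast; linarith
    _ = 2 ^ a * (T : ℝ) ^ a := Real.mul_rpow (by norm_num) (by positivity)
    _ ≤ 2 * (T : ℝ) ^ a := by
        gcongr
        calc (2 : ℝ) ^ a ≤ 2 ^ (1 : ℝ) := Real.rpow_le_rpow_of_exponent_le (by norm_num) ha1
          _ = 2 := by norm_num

lemma sum_one_div_rpow_le {a : ℝ} (ha : 0 < a) (ha1 : a ≤ 1) {T : ℕ} (hT : 1 ≤ T) :
    ∑ t ∈ Icc 1 T, 1 / ((t + 1 : ℕ) : ℝ) ^ (1 - a) ≤ 2 / a * (T : ℝ) ^ a := by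
  have h := sum_Icc_le_of_step (a := fun t => a * (1 / ((t + 1 : ℕ) : ℝ) ^ (1 - a)))
    (b := fun t => ((t + 1 : ℕ) : ℝ) ^ a) (by simp)
    (fun t => by
      have := rpow_sub_rpow_ge ha ha1 (t + 1)
      linarith) T
  rw [← Finset.mul_sum] at h
  have h2 := succ_rpow_le_two_mul ha.le ha1 hT
  rw [div_mul_eq_mul_div, le_div_iff₀ ha]
  linarith

/-- The increment of `t ^ (1 - κ)` is at most `(t + 1) ^ (-κ)`. -/
lemma rpow_one_sub_increment_le {κ : ℝ} (hκ : 0 ≤ κ) {t : ℕ} (ht : 1 ≤ t) :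
    ((t + 1 : ℕ) : ℝ) ^ (1 - κ) - (t : ℝ) ^ (1 - κ) ≤ 1 / ((t + 1 : ℕ) : ℝ) ^ κ := by
  have ht' : (0 : ℝ) < t := by exact_mod_cast ht
  have hs : (0 : ℝ) < ((t + 1 : ℕ) : ℝ) := by positivity
  rw [Real.rpow_sub hs, Real.rpow_sub ht', Real.rpow_one, Real.rpow_one]
  have h1 : (t : ℝ) / ((t + 1 : ℕ) : ℝ) ^ κ ≤ t / (t : ℝ) ^ κ := by
    gcongr
    omega
  have h2 : ((t + 1 : ℕ) : ℝ) / ((t + 1 : ℕ) : ℝ) ^ κ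
      = t / ((t + 1 : ℕ) : ℝ) ^ κ + 1 / ((t + 1 : ℕ) : ℝ) ^ κ := by
    rw [← add_div]; push_cast; rfl
  linarith

lemma sum_one_div_sqrt_le (T : ℕ) :
    ∑ t ∈ Icc 1 T, 1 / √((t + 1 : ℕ) : ℝ) ≤ 2 * √((T + 1 : ℕ) : ℝ) := by
  apply sum_Icc_le_of_step (b := fun T : ℕ => 2 * √((T + 1 : ℕ) : ℝ)) (by positivity)
  intro t
  have h1 : (0 : ℝ) < √((t + 1 + 1 : ℕ) : ℝ) := Real.sqrt_pos.2 (by positivity)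
  have e1 := Real.sq_sqrt (show (0 : ℝ) ≤ ((t + 1 + 1 : ℕ) : ℝ) by positivity)
  have e2 := Real.sq_sqrt (show (0 : ℝ) ≤ ((t + 1 : ℕ) : ℝ) by positivity)
  rw [← le_sub_iff_add_le, div_le_iff₀ h1]
  push_cast at *
  -- With u² - v² = 1, the inequality 1 ≤ 2u(u - v) is (u - v)² ≥ 0.
  nlinarith [sq_nonneg (√((t : ℝ) + 1 + 1) - √((t : ℝ) + 1))]

/-! ### Thresholds -/

lemma cumThreshold_succ (τ : ℕ → ℝ) (t : ℕ) :
    cumThreshold τ (t + 1) = cumThreshold τ t + τ (t + 1) :=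
  Finset.sum_Icc_succ_top (by omega) _

/-- Thresholds which are nonnegative and nonincreasing up to the factor `K`. -/
structure QuasiAntitone (τ : ℕ → ℝ) (K : ℝ) : Prop where
  nonneg : ∀ t, 1 ≤ t → 0 ≤ τ t
  one_pos : 0 < τ 1
  one_le : 1 ≤ K
  le_mul : ∀ r s, 1 ≤ r → r ≤ s → τ s ≤ K * τ r

/-- The thresholds decrease only from index 2 on, so the single possible jump, from `τ 1` to `τ 2`,
sets the factor. -/
lemma quasiAntitone_of_antitone {τ : ℕ → ℝ} (h0 : ∀ t, 1 ≤ t → 0 ≤ τ t)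
    (ha : ∀ t, 2 ≤ t → τ (t + 1) ≤ τ t) (h1 : 0 < τ 1) :
    QuasiAntitone τ (max 1 (τ 2 / τ 1)) := by
  have mono : ∀ r s, 2 ≤ r → r ≤ s → τ s ≤ τ r := by
    intro r s hr hrs
    induction s, hrs using Nat.le_induction with
    | base => exact le_rfl
    | succ s hs ih => exact (ha s (hr.trans hs)).trans ih
  refine ⟨h0, h1, le_max_left _ _, fun r s hr hrs => ?_⟩
  have hr0 := h0 r hr
  rcases hr.eq_or_lt with rfl | hr
  · rcases hrs.eq_or_lt with rfl | hs
    · nlinarith [le_max_left 1 (τ 2 / τ 1)]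
    · calc τ s ≤ τ 2 := mono 2 s le_rfl hs
        _ = τ 2 / τ 1 * τ 1 := by field_simp
        _ ≤ _ := by gcongr; exact le_max_right _ _
  · nlinarith [le_max_left 1 (τ 2 / τ 1), mono r s hr hrs]

namespace QuasiAntitone
variable {τ : ℕ → ℝ} {K : ℝ}

lemma cum_mono (h : QuasiAntitone τ K) : Monotone (cumThreshold τ) :=
  monotone_nat_of_le_succ fun t => by
    rw [cumThreshold_succ]; linarith [h.nonneg (t + 1) (by omega)]

lemma one_le_cum (h : QuasiAntitone τ K) {t : ℕ} (ht : 1 ≤ t) : τ 1 ≤ cumThreshold τ t := by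
  simpa [cumThreshold] using h.cum_mono ht

lemma cum_pos (h : QuasiAntitone τ K) {t : ℕ} (ht : 1 ≤ t) : 0 < cumThreshold τ t :=
  h.one_pos.trans_le (h.one_le_cum ht)

lemma cum_nonneg (h : QuasiAntitone τ K) (t : ℕ) : 0 ≤ cumThreshold τ t :=
  Finset.sum_nonneg fun s hs => h.nonneg s (Finset.mem_Icc.1 hs).1

lemma mul_le_cum (h : QuasiAntitone τ K) {t s : ℕ} (hts : t ≤ s) :
    t * τ s ≤ K * cumThreshold τ t := by
  rw [cumThreshold, Finset.mul_sum]
  calc (t : ℝ) * τ s = ∑ r ∈ Icc 1 t, τ s := by simp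
    _ ≤ _ := Finset.sum_le_sum fun r hr =>
      h.le_mul r s (Finset.mem_Icc.1 hr).1 ((Finset.mem_Icc.1 hr).2.trans hts)

/-- Averages of the thresholds are nonincreasing up to the factor `K`. -/
lemma cum_average (h : QuasiAntitone τ K) {t T : ℕ} (hT : t ≤ T) :
    t * cumThreshold τ T ≤ K * T * cumThreshold τ t := by
  induction T, hT using Nat.le_induction with
  | base =>
    have := mul_nonneg (Nat.cast_nonneg (α := ℝ) t) (h.cum_nonneg t)
    nlinarith [h.one_le]
  | succ T hT ih =>
    rw [cumThreshold_succ]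
    push_cast
    nlinarith [h.mul_le_cum (hT.trans (Nat.le_succ T))]

lemma cum_le (h : QuasiAntitone τ K) {T : ℕ} (hT : 1 ≤ T) :
    cumThreshold τ T ≤ K * τ 1 * T := by
  have := h.cum_average hT
  simp only [Nat.cast_one, one_mul] at this
  have h1 : cumThreshold τ 1 = τ 1 := by simp [cumThreshold]
  rw [h1] at this
  linarith

/-- Since Ψ_T = O(T), terms linear in Ψ_T are absorbed into √(Ψ_T T). -/
lemma cum_le_sqrt (h : QuasiAntitone τ K) {T : ℕ} (hT : 1 ≤ T) :
    cumThreshold τ T ≤ √(K * τ 1) * √(cumThreshold τ T * T) := by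
  have h0 := h.cum_nonneg T
  have hK := h.one_le
  have h1 := h.one_pos
  rw [← Real.sqrt_mul (by positivity)]
  apply Real.le_sqrt_of_sq_le
  nlinarith [h.cum_le hT]

lemma sqrt_cum_mul_le (h : QuasiAntitone τ K) {T : ℕ} (hT : 1 ≤ T) :
    √(cumThreshold τ T * T) ≤ √(K * τ 1) * T := by
  have hK := h.one_le
  have h1 := h.one_pos
  have h2 : √(K * τ 1) * T = √(K * τ 1 * T ^ 2) := by
    rw [Real.sqrt_mul (x := K * τ 1) (by positivity), Real.sqrt_sq (by positivity)]
  rw [h2]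
  apply Real.sqrt_le_sqrt
  have : (0 : ℝ) ≤ T := by positivity
  nlinarith [h.cum_le hT]

/-- Positivity of `τ 1` keeps Ψ_T away from zero; without it √T could exceed the target rate. -/
lemma sqrt_le_sqrt_cum_mul (h : QuasiAntitone τ K) {T : ℕ} (hT : 1 ≤ T) :
    √T ≤ 1 / √(τ 1) * √(cumThreshold τ T * T) := by
  have h1 := h.one_pos
  rw [div_mul_eq_mul_div, le_div_iff₀ (Real.sqrt_pos.2 h1), ← Real.sqrt_mul (by positivity),
    one_mul]
  apply Real.sqrt_le_sqrt
  have : (0 : ℝ) ≤ T := by positivity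
  nlinarith [h.one_le_cum hT]

lemma sum_succ_le (h : QuasiAntitone τ K) (T : ℕ) :
    ∑ t ∈ Icc 1 T, τ (t + 1) ≤ K * cumThreshold τ T := by
  rw [cumThreshold, Finset.mul_sum]
  exact Finset.sum_le_sum fun t ht => h.le_mul t (t + 1) (Finset.mem_Icc.1 ht).1 (by omega)

lemma cum_succ_le (h : QuasiAntitone τ K) {T : ℕ} (hT : 1 ≤ T) :
    cumThreshold τ (T + 1) ≤ 2 * K * cumThreshold τ T := by
  rw [cumThreshold_succ]
  have h1 := h.mul_le_cum (Nat.le_succ T)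
  have h2 := h.nonneg (T + 1) (by omega)
  have h3 : (1 : ℝ) ≤ T := by exact_mod_cast hT
  nlinarith [h.one_le, h.cum_nonneg T]

end QuasiAntitone

lemma sqrt_succ_le {T : ℕ} (hT : 1 ≤ T) : √((T + 1 : ℕ) : ℝ) ≤ 2 * √T := by
  have h3 : (1 : ℝ) ≤ T := by exact_mod_cast hT
  calc √((T + 1 : ℕ) : ℝ) ≤ √(2 ^ 2 * T) := by
        apply Real.sqrt_le_sqrt; push_cast; linarith
    _ = 2 * √T := by rw [Real.sqrt_mul (by norm_num), Real.sqrt_sq (by norm_num)]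

/-- The primal step size `α_t`. -/
def stepSize (τ : ℕ → ℝ) (t : ℕ) : ℝ := √(cumThreshold τ t / t)

namespace QuasiAntitone
variable {τ : ℕ → ℝ} {K : ℝ}

lemma stepSize_pos (h : QuasiAntitone τ K) {t : ℕ} (ht : 1 ≤ t) : 0 < stepSize τ t :=
  Real.sqrt_pos.2 (div_pos (h.cum_pos ht) (by exact_mod_cast ht))

lemma inv_stepSize (τ : ℕ → ℝ) (t : ℕ) :
    1 / stepSize τ t = √t / √(cumThreshold τ t) := by
  rw [stepSize, one_div, ← Real.sqrt_inv, inv_div, Real.sqrt_div (by positivity)]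

lemma sum_stepSize_le (h : QuasiAntitone τ K) {T : ℕ} (hT : 1 ≤ T) :
    ∑ t ∈ Icc 1 T, stepSize τ (t + 1) ≤ 4 * √(2 * K) * √(cumThreshold τ T * T) := by
  have hK := h.one_le
  calc ∑ t ∈ Icc 1 T, stepSize τ (t + 1)
      ≤ ∑ t ∈ Icc 1 T, √(2 * K * cumThreshold τ T) * (1 / √((t + 1 : ℕ) : ℝ)) := by
        apply Finset.sum_le_sum
        intro t ht
        rw [stepSize, Real.sqrt_div (h.cum_nonneg _), mul_one_div]
        gcongr
        refine (h.cum_mono ?_).trans (h.cum_succ_le hT)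
        have := (Finset.mem_Icc.1 ht).2
        omega
    _ = √(2 * K * cumThreshold τ T) * ∑ t ∈ Icc 1 T, (1 / √((t + 1 : ℕ) : ℝ)) := by
        rw [Finset.mul_sum]
    _ ≤ √(2 * K * cumThreshold τ T) * (2 * (2 * √T)) := by
        gcongr
        exact (sum_one_div_sqrt_le T).trans (by gcongr; exact sqrt_succ_le hT)
    _ = _ := by
        rw [Real.sqrt_mul (by positivity), Real.sqrt_mul (h.cum_nonneg T)]; ring

/-- Discrete form of ∫ dΨ/√Ψ = 2√Ψ. -/
lemma sum_div_sqrt_cum_le (h : QuasiAntitone τ K) (T : ℕ) :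
    ∑ t ∈ Icc 1 T, τ t / √(cumThreshold τ t) ≤ 2 * √(cumThreshold τ T) := by
  apply sum_Icc_le_of_step (b := fun t => 2 * √(cumThreshold τ t)) (by positivity)
  intro t
  have hp := Real.sqrt_pos.2 (h.cum_pos (t := t + 1) (by omega))
  have e1 := Real.sq_sqrt (h.cum_nonneg (t + 1))
  have e2 := Real.sq_sqrt (h.cum_nonneg t)
  have e3 := cumThreshold_succ τ t
  rw [← le_sub_iff_add_le, div_le_iff₀ hp]
  nlinarith [sq_nonneg (√(cumThreshold τ (t + 1)) - √(cumThreshold τ t))]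

lemma sum_div_stepSize_le (h : QuasiAntitone τ K) {T : ℕ} (hT : 1 ≤ T) :
    ∑ t ∈ Icc 1 T, τ t / stepSize τ (t + 1) ≤ 4 * √(cumThreshold τ T * T) := by
  calc ∑ t ∈ Icc 1 T, τ t / stepSize τ (t + 1)
      ≤ ∑ t ∈ Icc 1 T, 2 * √T * (τ t / √(cumThreshold τ t)) := by
        apply Finset.sum_le_sum
        intro t ht
        obtain ⟨ht1, ht2⟩ := Finset.mem_Icc.1 ht
        have e := inv_stepSize τ (t + 1)
        have h1 : √((t + 1 : ℕ) : ℝ) ≤ 2 * √T :=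
          (sqrt_succ_le ht1).trans (by gcongr)
        have h2 : √(cumThreshold τ t) ≤ √(cumThreshold τ (t + 1)) :=
          Real.sqrt_le_sqrt (h.cum_mono (Nat.le_succ t))
        have h3 := Real.sqrt_pos.2 (h.cum_pos ht1)
        rw [div_eq_mul_one_div, e, mul_comm (2 * √(T : ℝ)), div_mul_eq_mul_div, ← mul_div_assoc]
        have := h.nonneg t ht1
        gcongr
    _ = 2 * √T * ∑ t ∈ Icc 1 T, τ t / √(cumThreshold τ t) := by rw [Finset.mul_sum]
    _ ≤ 2 * √T * (2 * √(cumThreshold τ T)) := by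
        gcongr
        exact h.sum_div_sqrt_cum_le T
    _ = _ := by rw [Real.sqrt_mul (h.cum_nonneg T)]; ring

/-- The inverse step size need not be monotone, as the thresholds are nonincreasing only up to a
factor. An upper bound on its increments that itself telescopes is enough. -/
lemma inv_stepSize_increment_le (h : QuasiAntitone τ K) {t : ℕ} (ht : 1 ≤ t) :
    1 / stepSize τ (t + 1) - 1 / stepSize τ t ≤ (√((t + 1 : ℕ) : ℝ) - √t) / √(τ 1) := by
  rw [inv_stepSize, inv_stepSize]
  have h0 := Real.sqrt_pos.2 (h.cum_pos ht)
  have h2 : √(cumThreshold τ t) ≤ √(cumThreshold τ (t + 1)) :=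
    Real.sqrt_le_sqrt (h.cum_mono (Nat.le_succ t))
  have h3 : √(τ 1) ≤ √(cumThreshold τ (t + 1)) :=
    Real.sqrt_le_sqrt (h.one_le_cum (by omega))
  have h4 := Real.sqrt_pos.2 h.one_pos
  have h5 : √(t : ℝ) ≤ √((t + 1 : ℕ) : ℝ) := Real.sqrt_le_sqrt (by push_cast; linarith)
  calc √((t + 1 : ℕ) : ℝ) / √(cumThreshold τ (t + 1)) - √t / √(cumThreshold τ t)
      ≤ √((t + 1 : ℕ) : ℝ) / √(cumThreshold τ (t + 1)) - √t / √(cumThreshold τ (t + 1)) := by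
        gcongr
    _ = (√((t + 1 : ℕ) : ℝ) - √t) / √(cumThreshold τ (t + 1)) := by rw [sub_div]
    _ ≤ _ := by
        have : 0 ≤ √((t + 1 : ℕ) : ℝ) - √t := by linarith
        gcongr

/-- This is `cum_average` under the square root; it supplies the coefficient of the path length. -/
lemma inv_stepSize_le (h : QuasiAntitone τ K) {t T : ℕ} (ht : 1 ≤ t) (hT : t ≤ T) :
    1 / stepSize τ t ≤ √K * √((cumThreshold τ T)⁻¹ * T) := by
  have hK := h.one_le
  rw [← Real.sqrt_mul (by positivity), stepSize, one_div, ← Real.sqrt_inv, inv_div]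
  apply Real.sqrt_le_sqrt
  have h1 := h.cum_pos ht
  have h2 := h.cum_pos (ht.trans hT)
  rw [div_le_iff₀ h1, ← sub_nonneg]
  have h3 := h.cum_average hT
  have : K * ((cumThreshold τ T)⁻¹ * ↑T) * cumThreshold τ t - ↑t
    = (K * T * cumThreshold τ t - t * cumThreshold τ T) / cumThreshold τ T := by
    field_simp
  rw [this]
  apply div_nonneg (by linarith) h2.le

/-- Telescoping of `(D_t - D'_t) / α_{t+1}` when `D_{t+1} ≤ D'_t + p_t`. -/
lemma sum_telescope_le (h : QuasiAntitone τ K) {D D' p : ℕ → ℝ} {M : ℝ} {T : ℕ} (hT : 1 ≤ T)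
    (hD : ∀ t, 1 ≤ t → t ≤ T → 0 ≤ D t ∧ D t ≤ M) (hD' : ∀ t, 1 ≤ t → 0 ≤ D' t)
    (hp : ∀ t, 1 ≤ t → 0 ≤ p t)
    (hstep : ∀ t, 1 ≤ t → t < T → D (t + 1) ≤ D' t + p t) :
    ∑ t ∈ Icc 1 T, (D t - D' t) / stepSize τ (t + 1)
      ≤ M * (2 / τ 1 * √(cumThreshold τ T * T))
        + √K * √((cumThreshold τ T)⁻¹ * T) * ∑ t ∈ Ico 1 T, p t := by
  have hM : 0 ≤ M := (hD 1 le_rfl hT).1.trans (hD 1 le_rfl hT).2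
  have h1 := h.one_pos
  have hs1 := Real.sqrt_pos.2 h1
  set A := √K * √((cumThreshold τ T)⁻¹ * T) with hA
  -- The invariant retains the last `- D' S / stepSize τ (S + 1)`: the next step spends it on `D (S
  -- + 1) ≤ D' S + p S`, and the change of step size is paid by the growing multiple of `M`.
  have key : ∀ S, 1 ≤ S → S ≤ T → ∑ t ∈ Icc 1 S, (D t - D' t) / stepSize τ (t + 1)
      ≤ M * (√((S + 1 : ℕ) : ℝ) / √(τ 1)) + A * ∑ t ∈ Ico 1 S, p t
        - D' S / stepSize τ (S + 1) := by
    intro S hS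
    induction S, hS using Nat.le_induction with
    | base =>
      intro _
      have h3 : 1 / stepSize τ (1 + 1) ≤ √((1 + 1 : ℕ) : ℝ) / √(τ 1) := by
        rw [inv_stepSize]
        gcongr
        exact h.one_le_cum (by omega)
      have h4 : D 1 / stepSize τ (1 + 1) ≤ M * (√((1 + 1 : ℕ) : ℝ) / √(τ 1)) := by
        rw [div_eq_mul_one_div]
        have := (h.stepSize_pos (t := 1 + 1) (by omega))
        exact mul_le_mul (hD 1 le_rfl hT).2 h3 (by positivity) hM
      simp only [Icc_self, sum_singleton, Ico_self, sum_empty, mul_zero, add_zero, sub_div]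
      linarith
    | succ S hS ih =>
      intro hST
      have ih := ih (by omega)
      rw [Finset.sum_Icc_succ_top (by omega), Finset.sum_Ico_succ_top hS]
      have hinc := h.inv_stepSize_increment_le (t := S + 1) (by omega)
      have hle := h.inv_stepSize_le (t := S + 1) (T := T) (by omega) hST
      have hpos := h.stepSize_pos (t := S + 1) (by omega)
      have hdiff : 0 ≤ (√((S + 1 + 1 : ℕ) : ℝ) - √((S + 1 : ℕ) : ℝ)) / √(τ 1) := by
        apply div_nonneg _ hs1.le
        rw [sub_nonneg]
        exact Real.sqrt_le_sqrt (by push_cast; linarith)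
      obtain ⟨d0, dM⟩ := hD (S + 1) (by omega) hST
      have e1 : D (S + 1) * (1 / stepSize τ (S + 1 + 1) - 1 / stepSize τ (S + 1))
          ≤ M * ((√((S + 1 + 1 : ℕ) : ℝ) - √((S + 1 : ℕ) : ℝ)) / √(τ 1)) :=
        (mul_le_mul_of_nonneg_left hinc d0).trans (mul_le_mul_of_nonneg_right dM hdiff)
      have e2 : D (S + 1) * (1 / stepSize τ (S + 1))
          ≤ (D' S + p S) * (1 / stepSize τ (S + 1)) :=
        mul_le_mul_of_nonneg_right (hstep S hS (by omega)) (by positivity)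
      have e3 : p S * (1 / stepSize τ (S + 1)) ≤ p S * A :=
        mul_le_mul_of_nonneg_left hle (hp S hS)
      have e4 : M * ((√((S + 1 + 1 : ℕ) : ℝ) - √((S + 1 : ℕ) : ℝ)) / √(τ 1))
        = M * (√((S + 1 + 1 : ℕ) : ℝ) / √(τ 1)) - M * (√((S + 1 : ℕ) : ℝ) / √(τ 1)) := by ring
      rw [sub_div, div_eq_mul_one_div (D (S + 1)), mul_add]
      rw [div_eq_mul_one_div (D' S)] at ih
      nlinarith
  have hfin := key T hT le_rfl
  have hpos := h.stepSize_pos (t := T + 1) (by omega)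
  have h5 : 0 ≤ D' T / stepSize τ (T + 1) := div_nonneg (hD' T hT) hpos.le
  have h6 : √((T + 1 : ℕ) : ℝ) / √(τ 1) ≤ 2 / τ 1 * √(cumThreshold τ T * T) := by
    have := (sqrt_succ_le hT).trans (mul_le_mul_of_nonneg_left (h.sqrt_le_sqrt_cum_mul hT) zero_le_two)
    rw [div_le_iff₀ hs1]
    refine this.trans (le_of_eq ?_)
    have e := Real.sq_sqrt h1.le
    field_simp
    rw [e, mul_comm]
  have := mul_le_mul_of_nonneg_left h6 hM
  linarith

end QuasiAntitone

/-! ### Mixing -/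

/-- The product `W_{s+l-1} ⋯ W_{s+1} W_s`. -/
def weightProduct {n : ℕ} (W : ℕ → Matrix (Fin n) (Fin n) ℝ) (s : ℕ) :
    ℕ → Matrix (Fin n) (Fin n) ℝ
  | 0 => 1
  | l + 1 => W (s + l) * weightProduct W s l

namespace Network.Regular
variable {n : ℕ} {N : Network n} {w : ℝ} {B : ℕ}

lemma weight_nonneg (h : N.Regular w B) {t : ℕ} (ht : 1 ≤ t) (i j : Fin n) : 0 ≤ N.W t i j := by
  by_cases hij : (N.graph t).Adj j i ∨ i = j
  · exact (h.weight_pos t ht i j hij).le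
  · exact (h.weight_zero t ht i j hij).ge

lemma weightProduct_nonneg (h : N.Regular w B) {s : ℕ} (hs : 1 ≤ s) (l : ℕ) (i j : Fin n) :
    0 ≤ weightProduct N.W s l i j := by
  induction l generalizing i with
  | zero => simp only [weightProduct, Matrix.one_apply]; split_ifs <;> norm_num
  | succ l ih =>
    rw [weightProduct, Matrix.mul_apply]
    exact Finset.sum_nonneg fun k _ => mul_nonneg (h.weight_nonneg (by omega) i k) (ih k)

lemma weightProduct_row_sum (h : N.Regular w B) {s : ℕ} (hs : 1 ≤ s) (l : ℕ) (i : Fin n) :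
    ∑ j, weightProduct N.W s l i j = 1 := by
  induction l generalizing i with
  | zero => simp [weightProduct, Matrix.one_apply]
  | succ l ih =>
    simp only [weightProduct, Matrix.mul_apply]
    rw [Finset.sum_comm]
    simp only [← Finset.mul_sum, ih, mul_one]
    exact h.row_sum _ (by omega) i

/-- A positive entry has a positive path, and one path contributes at least `w` per round. -/
lemma weightProduct_ge (h : N.Regular w B) (hw : 0 < w) {s : ℕ} (hs : 1 ≤ s) (l : ℕ) (i j : Fin n)
    (hpos : 0 < weightProduct N.W s l i j) : w ^ l ≤ weightProduct N.W s l i j := by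
  induction l generalizing i with
  | zero =>
    simp only [weightProduct, Matrix.one_apply] at hpos ⊢
    split_ifs at hpos ⊢ <;> simp_all
  | succ l ih =>
    rw [weightProduct, Matrix.mul_apply] at hpos ⊢
    obtain ⟨k, -, hk⟩ := Finset.exists_lt_of_sum_lt (f := fun _ => (0 : ℝ))
      (by simpa using hpos)
    have hW := h.weight_nonneg (t := s + l) (by omega) i k
    have hP := h.weightProduct_nonneg hs l k j
    have hW' : 0 < N.W (s + l) i k := lt_of_le_of_ne hW fun e => by simp [← e] at hk
    have hP' : 0 < weightProduct N.W s l k j := lt_of_le_of_ne hP fun e => by simp [← e] at hk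
    calc w ^ (l + 1) = w * w ^ l := pow_succ' w l
      _ ≤ N.W (s + l) i k * weightProduct N.W s l k j :=
        mul_le_mul (h.weight_ge _ (by omega) i k hW') (ih k hP') (by positivity) hW
      _ ≤ _ := Finset.single_le_sum (f := fun k => N.W (s + l) i k * weightProduct N.W s l k j)
        (fun k _ => mul_nonneg (h.weight_nonneg (by omega) i k)
          (h.weightProduct_nonneg hs l k j)) (Finset.mem_univ k)

lemma weightProduct_pos_succ (h : N.Regular w B) {s : ℕ} (hs : 1 ≤ s) {l : ℕ} {a b j : Fin n}
    (hab : (N.graph (s + l)).Adj a b ∨ b = a) (ha : 0 < weightProduct N.W s l a j) :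
    0 < weightProduct N.W s (l + 1) b j := by
  rw [weightProduct, Matrix.mul_apply]
  refine Finset.sum_pos' (fun k _ => mul_nonneg (h.weight_nonneg (by omega) b k)
    (h.weightProduct_nonneg hs l k j)) ⟨a, Finset.mem_univ a, ?_⟩
  exact mul_pos (h.weight_pos _ (by omega) b a hab) ha

lemma weightProduct_pos_mono (h : N.Regular w B) {s : ℕ} (hs : 1 ≤ s) {l l' : ℕ} (hl : l ≤ l')
    {a j : Fin n} (ha : 0 < weightProduct N.W s l a j) : 0 < weightProduct N.W s l' a j := by
  induction l', hl using Nat.le_induction with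
  | base => exact ha
  | succ l' _ ih => exact h.weightProduct_pos_succ hs (Or.inr rfl) ih

/-- A walk from `j` to `i` in the union of the next `B` graphs has an edge leaving the set of agents
already reached. That edge is present in one round of the window, and the positive diagonals carry
the mass up to that round and on to the end of the window. -/
lemma exists_new_agent (h : N.Regular w B) {s : ℕ} (hs : 1 ≤ s) {l : ℕ} {i j : Fin n}
    (hi : ¬ 0 < weightProduct N.W s l i j) (hj : 0 < weightProduct N.W s l j j) :
    ∃ b, ¬ 0 < weightProduct N.W s l b j ∧ 0 < weightProduct N.W s (l + B) b j := by
  have key := h.connected (s + l) (by omega) j i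
  induction key with
  | refl => exact absurd hj hi
  | @tail a b _ hab ih =>
    by_cases ha : 0 < weightProduct N.W s l a j
    · obtain ⟨k, hk, hadj⟩ := hab
      refine ⟨b, hi, ?_⟩
      have h1 := h.weightProduct_pos_mono hs (Nat.le_add_right l k) ha
      rw [add_assoc] at hadj
      exact h.weightProduct_pos_mono hs (by omega) (h.weightProduct_pos_succ hs (Or.inl hadj) h1)
    · exact ih ha

/-- The set of agents reached from `j` gains a member in every window of `B` rounds until it is
everything, so `n` windows suffice. -/
lemma weightProduct_pos (h : N.Regular w B) {s : ℕ} (hs : 1 ≤ s) (i j : Fin n) :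
    0 < weightProduct N.W s (n * B) i j := by
  classical
  set S : ℕ → Finset (Fin n) := fun l => univ.filter fun a => 0 < weightProduct N.W s l a j
    with hS
  have h0 : 0 < weightProduct N.W s 0 j j := by simp [weightProduct]
  have card : ∀ k, k ≤ (S (k * B)).card ∨ S (k * B) = univ := by
    intro k
    induction k with
    | zero => left; omega
    | succ k ih =>
      have hsub : S (k * B) ⊆ S ((k + 1) * B) := fun a ha => by
        simp only [hS, mem_filter, mem_univ, true_and] at ha ⊢
        exact h.weightProduct_pos_mono hs (Nat.mul_le_mul_right B (Nat.le_succ k)) ha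
      by_cases hu : S (k * B) = univ
      · right
        exact Finset.univ_subset_iff.1 (hu ▸ hsub)
      · left
        have hk : k ≤ (S (k * B)).card := ih.resolve_right hu
        obtain ⟨b, hb⟩ : ∃ b, b ∉ S (k * B) := by
          by_contra! hcon
          exact hu (Finset.eq_univ_iff_forall.2 hcon)
        have hb' : ¬ 0 < weightProduct N.W s (k * B) b j := by simpa [hS] using hb
        obtain ⟨c, hc1, hc2⟩ := h.exists_new_agent hs hb'
          (h.weightProduct_pos_mono hs (Nat.zero_le _) h0)
        have : S (k * B) ⊂ S ((k + 1) * B) := by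
          refine Finset.ssubset_iff_of_subset hsub |>.2 ⟨c, ?_, ?_⟩
          · simpa [hS, Nat.succ_mul] using hc2
          · simpa [hS] using hc1
        exact Nat.lt_of_le_of_lt hk (Finset.card_lt_card this)
  have hfull : S (n * B) = univ := by
    rcases card n with hc | hc
    · exact Finset.eq_univ_of_card _ (le_antisymm (by simpa using Finset.card_le_univ (S (n * B)))
        (by simpa using hc))
    · exact hc
  have hi : i ∈ S (n * B) := hfull ▸ Finset.mem_univ i
  simpa [hS] using hi

end Network.Regular

/-- Two weighted averages that share mass `η` at one point. -/
lemma norm_average_sub_le {F ι : Type*} [NormedAddCommGroup F] [NormedSpace ℝ F] [Fintype ι]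
    [DecidableEq ι] {a b : ι → ℝ} {v : ι → F} {η d : ℝ} (k : ι) (ha : ∀ i, 0 ≤ a i)
    (hb : ∀ i, 0 ≤ b i) (hak : η ≤ a k) (hbk : η ≤ b k) (ha1 : ∑ i, a i = 1) (hb1 : ∑ i, b i = 1)
    (hη : η < 1) (hd : ∀ i j, ‖v i - v j‖ ≤ d) :
    ‖∑ i, a i • v i - ∑ i, b i • v i‖ ≤ (1 - η) * d := by
  set a' : ι → ℝ := fun i => a i - if i = k then η else 0 with ha'
  set b' : ι → ℝ := fun i => b i - if i = k then η else 0 with hb'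
  have sa : ∑ i, a' i = 1 - η := by simp [ha', ha1]
  have sb : ∑ i, b' i = 1 - η := by simp [hb', hb1]
  have na : ∀ i, 0 ≤ a' i := fun i => by
    simp only [ha']; split_ifs with e
    · subst e; linarith
    · simpa using ha i
  have nb : ∀ i, 0 ≤ b' i := fun i => by
    simp only [hb']; split_ifs with e
    · subst e; linarith
    · simpa using hb i
  have e1 : ∑ i, a i • v i - ∑ i, b i • v i = ∑ i, a' i • v i - ∑ i, b' i • v i := by
    simp only [ha', hb', sub_smul, Finset.sum_sub_distrib]
    abel
  -- Once the shared mass is removed, both weight vectors have mass `1 - η`; pairing them by product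
  -- weights turns the difference into an average of pairwise differences. The extra factor `1 - η`
  -- is cancelled at the end.
  have e2 : (1 - η) • (∑ i, a' i • v i - ∑ i, b' i • v i)
      = ∑ i, ∑ j, (a' i * b' j) • (v i - v j) := by
    simp only [smul_sub, Finset.sum_sub_distrib]
    congr 1
    · simp only [mul_smul, ← Finset.sum_smul, ← Finset.smul_sum, sb]
      rw [Finset.smul_sum]
      exact Finset.sum_congr rfl fun i _ => smul_comm _ _ _
    · rw [Finset.sum_comm]
      simp only [← Finset.sum_smul, sa, mul_smul, Finset.smul_sum]
  have hpos : 0 < 1 - η := by linarith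
  have e3 : ‖(1 - η) • (∑ i, a' i • v i - ∑ i, b' i • v i)‖ ≤ (1 - η) * ((1 - η) * d) := by
    rw [e2]
    calc ‖∑ i, ∑ j, (a' i * b' j) • (v i - v j)‖
        ≤ ∑ i, ∑ j, (a' i * b' j) * d := by
          refine norm_sum_le_of_le _ fun i _ => norm_sum_le_of_le _ fun j _ => ?_
          rw [norm_smul, Real.norm_of_nonneg (mul_nonneg (na i) (nb j))]
          exact mul_le_mul_of_nonneg_left (hd i j) (mul_nonneg (na i) (nb j))
      _ = (1 - η) * ((1 - η) * d) := by
          simp only [← Finset.sum_mul, ← Finset.mul_sum, sa, sb]; ring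
  rw [norm_smul, Real.norm_of_nonneg hpos.le] at e3
  rw [e1]
  exact le_of_mul_le_mul_left e3 hpos

/-- The largest distance between the vectors of two agents at time `t`. -/
def disagreement {n p : ℕ} (v : Fin n → ℕ → E p) (t : ℕ) : ℝ :=
  ‖fun ij : Fin n × Fin n => v ij.1 t - v ij.2 t‖

section
variable {n p : ℕ}

lemma disagreement_nonneg (v : Fin n → ℕ → E p) (t : ℕ) : 0 ≤ disagreement v t := norm_nonneg _

lemma norm_sub_le_disagreement (v : Fin n → ℕ → E p) (t : ℕ) (i j : Fin n) :
    ‖v i t - v j t‖ ≤ disagreement v t :=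
  norm_le_pi_norm (fun ij : Fin n × Fin n => v ij.1 t - v ij.2 t) (i, j)

lemma disagreement_le {v : Fin n → ℕ → E p} {t : ℕ} {d : ℝ} (hd : 0 ≤ d)
    (h : ∀ i j, ‖v i t - v j t‖ ≤ d) : disagreement v t ≤ d :=
  (pi_norm_le_iff_of_nonneg hd).2 fun ij => h ij.1 ij.2

variable {N : Network n} {w : ℝ} {B : ℕ}

/-- Row-stochastic matrices do not enlarge the largest error among agents, so the perturbations
simply add up. -/
lemma norm_sub_weightProduct_le (h : N.Regular w B) {v δ : Fin n → ℕ → E p} {σ : ℕ → ℝ}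
    (hv : ∀ i t, 1 ≤ t → v i (t + 1) = ∑ j, N.W t i j • v j t + δ i t)
    (hδ : ∀ i t, 1 ≤ t → ‖δ i t‖ ≤ σ t) {s : ℕ} (hs : 1 ≤ s) (l : ℕ) (i : Fin n) :
    ‖v i (s + l) - ∑ j, weightProduct N.W s l i j • v j s‖ ≤ ∑ k ∈ range l, σ (s + k) := by
  induction l generalizing i with
  | zero => simp [weightProduct, Matrix.one_apply]
  | succ l ih =>
    have e : v i (s + (l + 1)) - ∑ j, weightProduct N.W s (l + 1) i j • v j s
        = ∑ k, N.W (s + l) i k • (v k (s + l) - ∑ j, weightProduct N.W s l k j • v j s)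
          + δ i (s + l) := by
      have e2 : ∑ j, weightProduct N.W s (l + 1) i j • v j s
          = ∑ k, N.W (s + l) i k • ∑ j, weightProduct N.W s l k j • v j s := by
        simp only [weightProduct, Matrix.mul_apply, Finset.sum_smul, Finset.smul_sum, mul_smul]
        rw [Finset.sum_comm]
      rw [← add_assoc, hv i (s + l) (by omega), e2]
      simp only [smul_sub, Finset.sum_sub_distrib]
      abel
    rw [e, Finset.sum_range_succ]
    refine (norm_add_le _ _).trans (add_le_add ?_ (hδ i _ (by omega)))
    calc _ ≤ ∑ k, N.W (s + l) i k * ∑ k ∈ range l, σ (s + k) := by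
          refine norm_sum_le_of_le _ fun k _ => ?_
          have := h.weight_nonneg (t := s + l) (by omega) i k
          rw [norm_smul, Real.norm_of_nonneg this]
          exact mul_le_mul_of_nonneg_left (ih k) this
      _ = _ := by rw [← Finset.sum_mul, h.row_sum _ (by omega), one_mul]

/-- Over `n * B` rounds all entries of the product are at least `w ^ (n * B)`, so any two rows share
that mass at any chosen column (here that of agent 0). The factor 2 counts the perturbations of both
agents. -/
lemma disagreement_window_le (h : N.Regular w B) (hw : 0 < w) (hw1 : w < 1) (hL : n * B ≠ 0)
    {v δ : Fin n → ℕ → E p} {σ : ℕ → ℝ}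
    (hv : ∀ i t, 1 ≤ t → v i (t + 1) = ∑ j, N.W t i j • v j t + δ i t)
    (hδ : ∀ i t, 1 ≤ t → ‖δ i t‖ ≤ σ t) {s : ℕ} (hs : 1 ≤ s) :
    disagreement v (s + n * B)
      ≤ (1 - w ^ (n * B)) * disagreement v s + 2 * ∑ k ∈ range (n * B), σ (s + k) := by
  have hlt : w ^ (n * B) < 1 := pow_lt_one₀ hw.le hw1 hL
  have n0 : 0 < n := Nat.pos_of_ne_zero fun e => by simp [e] at hL
  have d0 := disagreement_nonneg v s
  have s0 : 0 ≤ ∑ k ∈ range (n * B), σ (s + k) := Finset.sum_nonneg fun k _ =>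
    (norm_nonneg _).trans (hδ ⟨0, n0⟩ (s + k) (by omega))
  refine disagreement_le (by nlinarith) fun i j => ?_
  have h1 := norm_sub_weightProduct_le h hv hδ hs (n * B) i
  have h2 := norm_sub_weightProduct_le h hv hδ hs (n * B) j
  have h3 := norm_average_sub_le (v := fun k => v k s) (a := weightProduct N.W s (n * B) i)
    (b := weightProduct N.W s (n * B) j) (⟨0, n0⟩ : Fin n)
    (h.weightProduct_nonneg hs _ i) (h.weightProduct_nonneg hs _ j)
    (h.weightProduct_ge hw hs _ _ _ (h.weightProduct_pos hs _ _))
    (h.weightProduct_ge hw hs _ _ _ (h.weightProduct_pos hs _ _))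
    (h.weightProduct_row_sum hs _ i) (h.weightProduct_row_sum hs _ j) hlt
    (norm_sub_le_disagreement v s)
  rw [norm_sub_rev] at h2
  have h4 := norm_add₃_le (a := v i (s + n * B) - ∑ k, weightProduct N.W s (n * B) i k • v k s)
    (b := ∑ k, weightProduct N.W s (n * B) i k • v k s
      - ∑ k, weightProduct N.W s (n * B) j k • v k s)
    (c := ∑ k, weightProduct N.W s (n * B) j k • v k s - v j (s + n * B))
  have e : (v i (s + n * B) - ∑ k, weightProduct N.W s (n * B) i k • v k s)
    + (∑ k, weightProduct N.W s (n * B) i k • v k s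
      - ∑ k, weightProduct N.W s (n * B) j k • v k s)
    + (∑ k, weightProduct N.W s (n * B) j k • v k s - v j (s + n * B))
    = v i (s + n * B) - v j (s + n * B) := by abel
  rw [e] at h4
  linarith

lemma sum_Icc_one_eq_range (a : ℕ → ℝ) (T : ℕ) :
    ∑ t ∈ Icc 1 T, a t = ∑ t ∈ range T, a (t + 1) := by
  induction T with
  | zero => simp
  | succ T ih => rw [Finset.sum_Icc_succ_top (by omega), ih, Finset.sum_range_succ]

/-- Accumulated form of a recursion that contracts by `1 - η` over windows of length `L`. -/
lemma sum_le_of_window_contraction {d σ : ℕ → ℝ} {η M : ℝ} {L : ℕ} (hη : 0 < η)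
    (hd : ∀ t, 1 ≤ t → 0 ≤ d t) (hM : ∀ t, 1 ≤ t → d t ≤ M) (hσ : ∀ t, 1 ≤ t → 0 ≤ σ t)
    (hη1 : η ≤ 1)
    (hstep : ∀ t, 1 ≤ t → d (t + L) ≤ (1 - η) * d t + 2 * ∑ k ∈ range L, σ (t + k)) (T : ℕ) :
    ∑ t ∈ Icc 1 T, d t ≤ 2 * L / η * (M + ∑ t ∈ Icc 1 T, σ t) := by
  simp only [sum_Icc_one_eq_range]
  have hM0 : 0 ≤ M := (hd 1 le_rfl).trans (hM 1 le_rfl)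
  have short : ∀ S ≤ L, ∑ t ∈ range S, d (t + 1) ≤ L * M := by
    intro S hS
    calc ∑ t ∈ range S, d (t + 1) ≤ ∑ t ∈ range S, M :=
          Finset.sum_le_sum fun t _ => hM (t + 1) (by omega)
      _ = S * M := by simp
      _ ≤ L * M := by gcongr
  have hs0 : 0 ≤ ∑ t ∈ range T, σ (t + 1) := Finset.sum_nonneg fun t _ => hσ _ (by omega)
  have hL0 : (0 : ℝ) ≤ L := by positivity
  rw [div_mul_eq_mul_div, le_div_iff₀ hη]
  rcases le_total T L with hTL | hTL
  · have h1 := short T hTL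
    have h2 : 0 ≤ ∑ t ∈ range T, d (t + 1) := Finset.sum_nonneg fun t _ => hd _ (by omega)
    nlinarith [mul_nonneg hL0 hs0, mul_nonneg hL0 hM0]
  -- The whole sum is its first `L` terms plus a shifted sum. The shifted sum is at most `1 - η`
  -- times the whole plus `2 * L * ∑ σ`, as each perturbation lies in at most `L` windows. Solving
  -- for the whole sum gives the factor `1 / η`.
  · obtain ⟨S, rfl⟩ := Nat.exists_eq_add_of_le hTL
    have h1 : ∑ t ∈ range S, d (t + 1 + L) ≤ (1 - η) * ∑ t ∈ range S, d (t + 1)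
        + 2 * (L * ∑ t ∈ range (L + S), σ (t + 1)) := by
      calc ∑ t ∈ range S, d (t + 1 + L)
          ≤ ∑ t ∈ range S, ((1 - η) * d (t + 1) + 2 * ∑ k ∈ range L, σ (t + 1 + k)) :=
            Finset.sum_le_sum fun t _ => hstep (t + 1) (by omega)
        _ = (1 - η) * ∑ t ∈ range S, d (t + 1)
            + 2 * ∑ k ∈ range L, ∑ t ∈ range S, σ (t + 1 + k) := by
            rw [Finset.sum_add_distrib, ← Finset.mul_sum, ← Finset.mul_sum, Finset.sum_comm]
        _ ≤ _ := by
            gcongr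
            calc ∑ k ∈ range L, ∑ t ∈ range S, σ (t + 1 + k)
                ≤ ∑ k ∈ range L, ∑ t ∈ range (L + S), σ (t + 1) := by
                  refine Finset.sum_le_sum fun k hk => ?_
                  have hk' := Finset.mem_range.1 hk
                  calc ∑ t ∈ range S, σ (t + 1 + k)
                      = ∑ t ∈ range S, σ (k + t + 1) :=
                        Finset.sum_congr rfl fun t _ => by congr 1; omega
                    _ ≤ ∑ t ∈ range k, σ (t + 1) + ∑ t ∈ range S, σ (k + t + 1) :=
                        le_add_of_nonneg_left (Finset.sum_nonneg fun t _ => hσ _ (by omega))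
                    _ = ∑ t ∈ range (k + S), σ (t + 1) := (Finset.sum_range_add _ _ _).symm
                    _ ≤ _ := Finset.sum_le_sum_of_subset_of_nonneg
                        (Finset.range_mono (by omega)) fun t _ _ => hσ _ (by omega)
              _ = _ := by simp
    have h2 : ∑ t ∈ range (L + S), d (t + 1)
        = ∑ t ∈ range L, d (t + 1) + ∑ t ∈ range S, d (t + 1 + L) := by
      rw [Finset.sum_range_add]
      congr 1
      exact Finset.sum_congr rfl fun t _ => by congr 1; omega
    have h3 : ∑ t ∈ range S, d (t + 1) ≤ ∑ t ∈ range (L + S), d (t + 1) :=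
      Finset.sum_le_sum_of_subset_of_nonneg (Finset.range_mono (by omega))
        fun t _ _ => hd _ (by omega)
    have h4 := short L le_rfl
    have h5 := mul_nonneg hL0 hM0
    nlinarith [mul_le_mul_of_nonneg_left h3 (sub_nonneg.2 hη1)]

lemma sum_disagreement_le (h : N.Regular w B) (hw : 0 < w) (hw1 : w < 1) (hL : n * B ≠ 0)
    {v δ : Fin n → ℕ → E p} {σ : ℕ → ℝ} {M : ℝ}
    (hv : ∀ i t, 1 ≤ t → v i (t + 1) = ∑ j, N.W t i j • v j t + δ i t)
    (hδ : ∀ i t, 1 ≤ t → ‖δ i t‖ ≤ σ t)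
    (hM : ∀ t, 1 ≤ t → ∀ i j, ‖v i t - v j t‖ ≤ M) (T : ℕ) :
    ∑ t ∈ Icc 1 T, disagreement v t
      ≤ 2 * (n * B : ℕ) / w ^ (n * B) * (M + ∑ t ∈ Icc 1 T, σ t) := by
  have n0 : 0 < n := Nat.pos_of_ne_zero fun e => by simp [e] at hL
  have hM0 : 0 ≤ M := (norm_nonneg _).trans (hM 1 le_rfl ⟨0, n0⟩ ⟨0, n0⟩)
  exact sum_le_of_window_contraction (pow_pos hw _) (fun t _ => disagreement_nonneg v t)
    (fun t ht => disagreement_le hM0 (hM t ht))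
    (fun t ht => (norm_nonneg _).trans (hδ ⟨0, n0⟩ t ht)) (pow_le_one₀ hw.le hw1.le)
    (fun t ht => disagreement_window_le h hw hw1 hL hv hδ ht) T

end

/-! ### Positive parts and projections -/

lemma plus_apply {ι : Type} (v : EuclideanSpace ℝ ι) (k : ι) : plus v k = max (v k) 0 := rfl

lemma plus_nonneg {ι : Type} (v : EuclideanSpace ℝ ι) (k : ι) : 0 ≤ plus v k := le_max_right _ _

lemma norm_le_norm_of_abs_le {ι : Type} [Fintype ι] {u v : EuclideanSpace ℝ ι}
    (h : ∀ k, |u k| ≤ |v k|) : ‖u‖ ≤ ‖v‖ := by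
  rw [EuclideanSpace.norm_eq, EuclideanSpace.norm_eq]
  apply Real.sqrt_le_sqrt
  refine Finset.sum_le_sum fun k _ => ?_
  simpa only [Real.norm_eq_abs] using pow_le_pow_left₀ (abs_nonneg _) (h k) 2

lemma norm_plus_le {ι : Type} [Fintype ι] (v : EuclideanSpace ℝ ι) : ‖plus v‖ ≤ ‖v‖ := by
  refine norm_le_norm_of_abs_le fun k => ?_
  rw [abs_of_nonneg (plus_nonneg v k), plus_apply]
  exact max_le (le_abs_self _) (abs_nonneg _)

lemma norm_le_sum_abs {ι : Type} [Fintype ι] (v : EuclideanSpace ℝ ι) : ‖v‖ ≤ ∑ k, |v k| := by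
  rw [EuclideanSpace.norm_eq]
  refine Real.sqrt_le_iff.2 ⟨Finset.sum_nonneg fun k _ => abs_nonneg _, ?_⟩
  simp only [Real.norm_eq_abs]
  exact Finset.sum_sq_le_sq_sum_of_nonneg fun k _ => abs_nonneg _

lemma abs_apply_le_norm {ι : Type} [Fintype ι] (v : EuclideanSpace ℝ ι) (k : ι) : |v k| ≤ ‖v‖ :=
  PiLp.norm_apply_le v k

lemma inner_eq_sum_mul {r : ℕ} (u v : E r) : inner ℝ u v = ∑ k, u k * v k := by
  simp [PiLp.inner_apply, mul_comm]

variable {n p : ℕ} {m : Fin n → ℕ}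

lemma IsProjection.inner_le_zero {X : Set (E p)} (hX : Convex ℝ X) {v y : E p}
    (h : IsProjection X v y) {u : E p} (hu : u ∈ X) : inner ℝ (v - y) (u - y) ≤ 0 := by
  have : Nonempty X := ⟨⟨y, h.1⟩⟩
  refine (norm_eq_iInf_iff_real_inner_le_zero hX h.1).1 ?_ u hu
  apply le_antisymm
  · exact le_ciInf fun u => h.2 u u.2
  · exact ciInf_le ⟨0, by rintro _ ⟨u, rfl⟩; exact norm_nonneg _⟩ (⟨y, h.1⟩ : X)

/-- The obtuse-angle property, with the inner product expanded through ‖z - u‖² = ‖z - y‖² + 2⟨z -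
y, y - u⟩ + ‖y - u‖². -/
lemma IsProjection.inner_step_le {X : Set (E p)} (hX : Convex ℝ X) {z ω y : E p} {α : ℝ}
    (hα : 0 < α) (h : IsProjection X (z - α • ω) y) {u : E p} (hu : u ∈ X) :
    inner ℝ ω (y - u) ≤ (‖z - u‖ ^ 2 - ‖y - u‖ ^ 2 - ‖y - z‖ ^ 2) / (2 * α) := by
  have h1 := h.inner_le_zero hX hu
  have e1 : z - α • ω - y = (z - y) - α • ω := by abel
  have e2 : u - y = -(y - u) := by abel
  rw [e1, e2, inner_neg_right, inner_sub_left, real_inner_smul_left] at h1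
  have h2 := norm_add_sq_real (z - y) (y - u)
  rw [sub_add_sub_cancel, norm_sub_rev z y] at h2
  rw [le_div_iff₀ (by positivity)]
  linarith

/-! ### One step of the algorithm -/

/-- The average `z_{i,t+1}` of the broadcast decisions that agent `i` computes in round `t`. -/
def mixed (N : Network n) (xhat : Fin n → ℕ → E p) (i : Fin n) (t : ℕ) : E p :=
  ∑ j, N.W t i j • xhat j t

/-- The linearized constraint value that drives the dual update. -/
def dualDrift (P : Problem n p m) (x : Fin n → ℕ → E p)
    (D : (i : Fin n) → ℕ → (E p →L[ℝ] E (m i))) (i : Fin n) (t : ℕ) : E (m i) :=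
  plus (P.g i t (x i t)) + D i t (x i (t + 1) - x i t)

/-- Step sizes for which the dual variables stay bounded by a multiple of `1 / β`. -/
structure StepSizes (α β γ τ : ℕ → ℝ) : Prop where
  alpha_pos : ∀ t, 1 ≤ t → 0 < α t
  beta_nonneg : ∀ t, 1 ≤ t → 0 ≤ β t
  beta_anti : ∀ t, 1 ≤ t → β (t + 1) ≤ β t
  gamma_pos : ∀ t, 1 ≤ t → 0 < γ t
  beta_mul_gamma_le : ∀ t, 1 ≤ t → β t * γ t ≤ 1
  threshold_nonneg : ∀ t, 1 ≤ t → 0 ≤ τ t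

section Run
variable {P : Problem n p m} {N : Network n} {R F₁ F₂ w : ℝ} {B : ℕ} {α β γ τ : ℕ → ℝ}
  {x xhat : Fin n → ℕ → E p} {q : (i : Fin n) → ℕ → E (m i)}
  {D : (i : Fin n) → ℕ → (E p →L[ℝ] E (m i))}

lemma Problem.Regular.norm_sub_le (hP : P.Regular R F₁ F₂) {a b : E p} (ha : a ∈ P.X)
    (hb : b ∈ P.X) : ‖a - b‖ ≤ 2 * R := by
  linarith [_root_.norm_sub_le a b, hP.bounded a ha, hP.bounded b hb]

lemma Problem.Regular.loss_sub_le (hP : P.Regular R F₁ F₂) (i : Fin n) {t : ℕ} (ht : 1 ≤ t)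
    {a b : E p} (ha : a ∈ P.X) (hb : b ∈ P.X) : P.f i t a - P.f i t b ≤ F₂ * ‖a - b‖ := by
  have h1 := hP.loss_subgradient i t ht a ha b hb
  have h2 := real_inner_le_norm (P.df i t a) (a - b)
  have h3 := mul_le_mul_of_nonneg_right (hP.loss_subgradient_bound i t ht a ha)
    (norm_nonneg (a - b))
  have e : b - a = -(a - b) := by abel
  rw [e, inner_neg_right] at h1
  linarith

/-- The subgradient inequality is applied componentwise and the operator norm only afterwards, so no
dimension factor appears. -/
lemma Problem.Regular.norm_plus_constraint_le (hP : P.Regular R F₁ F₂) (i : Fin n) {t : ℕ}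
    (ht : 1 ≤ t) {a b : E p} (ha : a ∈ P.X) (hb : b ∈ P.X) :
    ‖plus (P.g i t a)‖ ≤ ‖plus (P.g i t b)‖ + F₂ * ‖a - b‖ := by
  have h1 := hP.constraint_subgradient i t ht a ha b hb
  set d : E (m i) := WithLp.toLp 2 fun k => |P.dg i t a (b - a) k| with hd
  have hdk : ∀ k, d k = |P.dg i t a (b - a) k| := fun k => rfl
  have h2 : ‖plus (P.g i t a)‖ ≤ ‖plus (P.g i t b) + d‖ := by
    refine norm_le_norm_of_abs_le fun k => ?_
    have e : (plus (P.g i t b) + d) k = plus (P.g i t b) k + d k := rfl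
    have h3 := neg_abs_le (P.dg i t a (b - a) k)
    have h4 := abs_nonneg (P.dg i t a (b - a) k)
    rw [abs_of_nonneg (plus_nonneg _ k), e, hdk,
      abs_of_nonneg (add_nonneg (plus_nonneg _ k) h4), plus_apply, plus_apply]
    apply max_le
    · linarith [h1 k, le_max_left (P.g i t b k) 0]
    · linarith [le_max_right (P.g i t b k) 0]
  have h5 : ‖d‖ ≤ ‖P.dg i t a (b - a)‖ :=
    norm_le_norm_of_abs_le fun k => by rw [hdk, abs_abs]
  have h6 := (P.dg i t a).le_of_opNorm_le (hP.constraint_subgradient_bound i t ht a ha) (b - a)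
  rw [norm_sub_rev b a] at h6
  linarith [norm_add_le (plus (P.g i t b)) d]

namespace IsRun

variable (hr : IsRun P N α β γ τ x xhat q D)
include hr

lemma x_mem {t : ℕ} (ht : 1 ≤ t) (i : Fin n) : x i t ∈ P.X := by
  rcases ht.eq_or_lt with rfl | ht
  · exact hr.init_x i
  · obtain ⟨s, rfl⟩ := Nat.exists_eq_add_of_le' (show 1 ≤ t by omega)
    exact (hr.primal i s (by omega)).1

lemma xhat_mem {t : ℕ} (ht : 1 ≤ t) (i : Fin n) : xhat i t ∈ P.X := by
  induction t, ht using Nat.le_induction with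
  | base => rw [hr.init_xhat]; exact hr.init_x i
  | succ t ht ih =>
    rcases le_or_gt (τ (t + 1)) ‖x i (t + 1) - xhat i t‖ with h | h
    · rw [hr.trigger i t ht h]; exact hr.x_mem (by omega) i
    · rw [hr.no_trigger i t ht h]; exact ih

lemma norm_sub_xhat_le (hs : StepSizes α β γ τ) {t : ℕ} (ht : 1 ≤ t) (i : Fin n) :
    ‖x i t - xhat i t‖ ≤ τ t := by
  rcases ht.eq_or_lt with rfl | ht
  · rw [hr.init_xhat, sub_self, norm_zero]; exact hs.threshold_nonneg 1 le_rfl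
  · obtain ⟨s, rfl⟩ := Nat.exists_eq_add_of_le' (show 1 ≤ t by omega)
    rcases le_or_gt (τ (s + 1)) ‖x i (s + 1) - xhat i s‖ with h | h
    · rw [hr.trigger i s (by omega) h, sub_self, norm_zero]
      exact hs.threshold_nonneg _ (by omega)
    · rw [hr.no_trigger i s (by omega) h]; exact h.le

lemma dual_nonneg {t : ℕ} (ht : 1 ≤ t) (i : Fin n) (k : Fin (m i)) : 0 ≤ q i t k := by
  rcases ht.eq_or_lt with rfl | ht
  · simp [hr.init_q]
  · obtain ⟨s, rfl⟩ := Nat.exists_eq_add_of_le' (show 1 ≤ t by omega)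
    rw [hr.dual i s (by omega)]; exact plus_nonneg _ k

lemma dual_eq {t : ℕ} (ht : 1 ≤ t) (i : Fin n) :
    q i (t + 1) = plus ((1 - β (t + 1) * γ (t + 1)) • q i t
      + γ (t + 1) • dualDrift P x D i t) := hr.dual i t ht

variable (hP : P.Regular R F₁ F₂)
include hP

lemma norm_gradient_apply_le {t : ℕ} (ht : 1 ≤ t) (i : Fin n) (v : E p) :
    ‖D i t v‖ ≤ F₂ * ‖v‖ := by
  have hx := hr.x_mem ht i
  refine le_trans ?_ ((P.dg i t (x i t)).le_of_opNorm_le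
    (hP.constraint_subgradient_bound i t ht _ hx) v)
  refine norm_le_norm_of_abs_le fun k => ?_
  obtain ⟨θ, h0, h1, h⟩ := (hr.observe i t ht).2 k
  rw [h v, abs_mul, abs_of_nonneg h0]
  exact mul_le_of_le_one_left (abs_nonneg _) h1

lemma norm_dualDrift_le (hF₂ : 0 ≤ F₂) {t : ℕ} (ht : 1 ≤ t) (i : Fin n) :
    ‖dualDrift P x D i t‖ ≤ F₁ + 2 * R * F₂ := by
  have hx := hr.x_mem ht i
  have h1 := hP.constraint_bound i t ht _ hx
  have h2 := hr.norm_gradient_apply_le hP ht i (x i (t + 1) - x i t)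
  have h3 := mul_le_mul_of_nonneg_left
    (hP.norm_sub_le (hr.x_mem (t := t + 1) (by omega) i) hx) hF₂
  have h4 := norm_add_le (plus (P.g i t (x i t))) (D i t (x i (t + 1) - x i t))
  have h5 := norm_plus_le (P.g i t (x i t))
  rw [dualDrift]
  linarith

/-- Multiplied by `β (t + 1)`, the update is a convex combination, with weights `1 - βγ` and `βγ`,
of the previous bound and the drift bound. Monotonicity of `β` carries the previous bound to the new
index. -/
lemma beta_mul_norm_dual_le (hs : StepSizes α β γ τ) (hF₂ : 0 ≤ F₂) {t : ℕ} (ht : 1 ≤ t)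
    (i : Fin n) : β t * ‖q i t‖ ≤ F₁ + 2 * R * F₂ := by
  have hB : 0 ≤ F₁ + 2 * R * F₂ :=
    (norm_nonneg _).trans (hr.norm_dualDrift_le hP hF₂ le_rfl i)
  induction t, ht using Nat.le_induction with
  | base => simpa [hr.init_q] using hB
  | succ t ht ih =>
    have b0 := hs.beta_nonneg (t + 1) (by omega)
    have g0 := hs.gamma_pos (t + 1) (by omega)
    have bg := hs.beta_mul_gamma_le (t + 1) (by omega)
    have h1 : ‖q i (t + 1)‖ ≤ (1 - β (t + 1) * γ (t + 1)) * ‖q i t‖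
        + γ (t + 1) * (F₁ + 2 * R * F₂) := by
      rw [hr.dual_eq ht]
      refine (norm_plus_le _).trans ((norm_add_le _ _).trans ?_)
      rw [norm_smul, norm_smul, Real.norm_of_nonneg (by linarith), Real.norm_of_nonneg g0.le]
      gcongr
      exact hr.norm_dualDrift_le hP hF₂ ht i
    have h2 : β (t + 1) * ‖q i t‖ ≤ F₁ + 2 * R * F₂ :=
      (mul_le_mul_of_nonneg_right (hs.beta_anti t ht) (norm_nonneg _)).trans ih
    nlinarith [mul_le_mul_of_nonneg_left h1 b0,
      mul_le_mul_of_nonneg_left h2 (show 0 ≤ 1 - β (t + 1) * γ (t + 1) by linarith)]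

lemma neg_inner_dualDrift_le (hs : StepSizes α β γ τ) (hF₂ : 0 ≤ F₂) {t : ℕ} (ht : 1 ≤ t)
    (i : Fin n) : -inner ℝ (q i t) (dualDrift P x D i t)
      ≤ (‖q i t‖ ^ 2 - ‖q i (t + 1)‖ ^ 2) / (2 * γ (t + 1)) - β (t + 1) * ‖q i t‖ ^ 2
        + 2 * (F₁ + 2 * R * F₂) ^ 2 * γ (t + 1) := by
  set b := dualDrift P x D i t with hb
  have b0 := hs.beta_nonneg (t + 1) (by omega)
  have g0 := hs.gamma_pos (t + 1) (by omega)
  -- The update read as a gradient step of length `γ (t + 1)` along the regularized drift `b - β (t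
  -- + 1) • q i t`, whose norm is at most twice the drift bound; this is the source of the final
  -- constant 2.
  have h1 : ‖q i (t + 1)‖ ^ 2 ≤ ‖q i t + γ (t + 1) • (b - β (t + 1) • q i t)‖ ^ 2 := by
    have e : q i t + γ (t + 1) • (b - β (t + 1) • q i t)
        = (1 - β (t + 1) * γ (t + 1)) • q i t + γ (t + 1) • b := by
      rw [smul_sub, sub_smul, one_smul, smul_smul, mul_comm (β (t + 1))]
      abel
    rw [e, hr.dual_eq ht]
    exact pow_le_pow_left₀ (norm_nonneg _) (norm_plus_le _) 2
  have h2 : ‖b - β (t + 1) • q i t‖ ≤ 2 * (F₁ + 2 * R * F₂) := by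
    have h3 := (mul_le_mul_of_nonneg_right (hs.beta_anti t ht) (norm_nonneg _)).trans
      (hr.beta_mul_norm_dual_le hP hs hF₂ ht i)
    have h4 := _root_.norm_sub_le b (β (t + 1) • q i t)
    rw [norm_smul, Real.norm_of_nonneg b0] at h4
    linarith [hr.norm_dualDrift_le hP hF₂ ht i]
  have h5 := pow_le_pow_left₀ (norm_nonneg _) h2 2
  rw [norm_add_sq_real, real_inner_smul_right, inner_sub_right, real_inner_smul_right,
    real_inner_self_eq_norm_sq, norm_smul, mul_pow, Real.norm_of_nonneg g0.le] at h1
  have h6 : (‖q i t‖ ^ 2 - ‖q i (t + 1)‖ ^ 2) / (2 * γ (t + 1)) ≥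
      -inner ℝ (q i t) b + β (t + 1) * ‖q i t‖ ^ 2 - 2 * (F₁ + 2 * R * F₂) ^ 2 * γ (t + 1) := by
    rw [ge_iff_le, le_div_iff₀ (by positivity)]
    nlinarith [mul_le_mul_of_nonneg_left h5 (sq_nonneg (γ (t + 1)))]
  linarith

/-- The regret of an agent for its own loss in one round. -/
lemma loss_sub_le (hs : StepSizes α β γ τ) (hF₂ : 0 ≤ F₂) {t : ℕ} (ht : 1 ≤ t) (i : Fin n)
    {y : E p} (hy : y ∈ P.X) (hgy : ∀ k, P.g i t y k ≤ 0) :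
    P.f i t (x i t) - P.f i t y ≤ F₂ * ‖x i t - x i (t + 1)‖
      + (‖mixed N xhat i t - y‖ ^ 2 - ‖x i (t + 1) - y‖ ^ 2
          - ‖x i (t + 1) - mixed N xhat i t‖ ^ 2) / (2 * α (t + 1))
      + ((‖q i t‖ ^ 2 - ‖q i (t + 1)‖ ^ 2) / (2 * γ (t + 1)) - β (t + 1) * ‖q i t‖ ^ 2
        + 2 * (F₁ + 2 * R * F₂) ^ 2 * γ (t + 1)) := by
  have hx := hr.x_mem ht i
  have h1 := hP.loss_subgradient i t ht _ hx y hy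
  have h2 := IsProjection.inner_step_le hP.convex (hs.alpha_pos (t + 1) (by omega))
    (hr.primal i t ht) hy
  have h3 := hr.neg_inner_dualDrift_le hP hs hF₂ ht i
  -- Feasibility of `y` makes the linearization of the positive part nonpositive at `y`, and
  -- nonnegative multipliers preserve the sign.
  have h4 : inner ℝ (q i t) (dualDrift P x D i t)
      ≤ inner ℝ (q i t) (D i t (x i (t + 1) - y)) := by
    rw [inner_eq_sum_mul, inner_eq_sum_mul]
    refine Finset.sum_le_sum fun k _ => mul_le_mul_of_nonneg_left ?_ (hr.dual_nonneg ht i k)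
    have h5 := (hr.observe i t ht).1 y hy k
    have e1 : plus (P.g i t y) k = 0 := max_eq_right (hgy k)
    have e2 : x i (t + 1) - y = (x i (t + 1) - x i t) - (y - x i t) := by abel
    have e3 : dualDrift P x D i t k
      = plus (P.g i t (x i t)) k + D i t (x i (t + 1) - x i t) k := rfl
    rw [e2, map_sub, e3, PiLp.sub_apply]
    simp only [e1] at h5
    linarith
  rw [inner_add_left, ContinuousLinearMap.adjoint_inner_left] at h2
  have h5 := (real_inner_le_norm (P.df i t (x i t)) (x i t - x i (t + 1))).trans
    (mul_le_mul_of_nonneg_right (hP.loss_subgradient_bound i t ht _ hx) (norm_nonneg _))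
  have e : y - x i t = -(x i t - x i (t + 1)) - (x i (t + 1) - y) := by abel
  rw [e, inner_sub_right, inner_neg_right] at h1
  rw [mixed]
  linarith

omit hr hP in
-- Jensen along the rows, then unit column sums; both halves of double stochasticity enter.
lemma _root_.EventTriggered.Network.Regular.sum_norm_mixed_sub_sq_le (hN : N.Regular w B)
    {t : ℕ} (ht : 1 ≤ t) (xhat : Fin n → ℕ → E p) (y : E p) :
    ∑ i, ‖mixed N xhat i t - y‖ ^ 2 ≤ ∑ j, ‖xhat j t - y‖ ^ 2 := by
  have hc : ConvexOn ℝ Set.univ fun v : E p => ‖v‖ ^ 2 :=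
    convexOn_univ_norm.pow (fun _ _ => norm_nonneg _) 2
  calc ∑ i, ‖mixed N xhat i t - y‖ ^ 2
      ≤ ∑ i, ∑ j, N.W t i j * ‖xhat j t - y‖ ^ 2 := by
        refine Finset.sum_le_sum fun i _ => ?_
        have h := hc.map_sum_le (t := univ) (w := N.W t i) (p := fun j => xhat j t - y)
          (fun j _ => hN.weight_nonneg ht i j) (hN.row_sum t ht i) (fun _ _ => Set.mem_univ _)
        have e : ∑ j, N.W t i j • (xhat j t - y) = mixed N xhat i t - y := by
          simp only [smul_sub, Finset.sum_sub_distrib, ← Finset.sum_smul, hN.row_sum t ht i,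
            one_smul, mixed]
        rw [e] at h
        simpa only [smul_eq_mul] using h
    _ = ∑ j, ‖xhat j t - y‖ ^ 2 := by
        rw [Finset.sum_comm]
        simp only [← Finset.sum_mul, hN.col_sum t ht, one_mul]

lemma norm_xhat_sub_sq_le (hs : StepSizes α β γ τ) {t : ℕ} (ht : 1 ≤ t) (j : Fin n) {y : E p}
    (hy : y ∈ P.X) : ‖xhat j t - y‖ ^ 2 ≤ ‖x j t - y‖ ^ 2 + 4 * R * τ t := by
  have h1 := hP.norm_sub_le (hr.xhat_mem ht j) hy
  have h2 := hP.norm_sub_le (hr.x_mem ht j) hy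
  have h3 := hr.norm_sub_xhat_le hs ht j
  have h4 : ‖xhat j t - y‖ ≤ ‖x j t - y‖ + τ t := by
    have := norm_add_le (xhat j t - x j t) (x j t - y)
    rw [sub_add_sub_cancel, norm_sub_rev (xhat j t) (x j t)] at this
    linarith
  have h5 := hs.threshold_nonneg t ht
  nlinarith [norm_nonneg (xhat j t - y), norm_nonneg (x j t - y)]

omit hr hP in
lemma norm_sub_mixed_le (hN : N.Regular w B) {t : ℕ} (ht : 1 ≤ t) (i : Fin n) :
    ‖xhat i t - mixed N xhat i t‖ ≤ disagreement xhat t := by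
  have e : xhat i t - mixed N xhat i t = ∑ j, N.W t i j • (xhat i t - xhat j t) := by
    simp only [smul_sub, Finset.sum_sub_distrib, ← Finset.sum_smul, hN.row_sum t ht i, one_smul,
      mixed]
  rw [e]
  calc _ ≤ ∑ j, N.W t i j * disagreement xhat t := by
        refine norm_sum_le_of_le _ fun j _ => ?_
        rw [norm_smul, Real.norm_of_nonneg (hN.weight_nonneg ht i j)]
        exact mul_le_mul_of_nonneg_left (norm_sub_le_disagreement _ _ _ _)
          (hN.weight_nonneg ht i j)
    _ = _ := by rw [← Finset.sum_mul, hN.row_sum t ht i, one_mul]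

omit hP in
lemma norm_sub_succ_le (hs : StepSizes α β γ τ) (hN : N.Regular w B) {t : ℕ} (ht : 1 ≤ t)
    (i : Fin n) : ‖x i t - x i (t + 1)‖
      ≤ τ t + disagreement xhat t + ‖x i (t + 1) - mixed N xhat i t‖ := by
  have h := norm_add₃_le (a := x i t - xhat i t) (b := xhat i t - mixed N xhat i t)
    (c := mixed N xhat i t - x i (t + 1))
  rw [sub_add_sub_cancel, sub_add_sub_cancel, norm_sub_rev (mixed N xhat i t)] at h
  linarith [hr.norm_sub_xhat_le hs ht i, norm_sub_mixed_le (xhat := xhat) hN ht i]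

omit hP in
lemma norm_sub_agents_le (hs : StepSizes α β γ τ) {t : ℕ} (ht : 1 ≤ t) (i j : Fin n) :
    ‖x i t - x j t‖ ≤ disagreement xhat t + 2 * τ t := by
  have h := norm_add₃_le (a := x i t - xhat i t) (b := xhat i t - xhat j t)
    (c := xhat j t - x j t)
  rw [sub_add_sub_cancel, sub_add_sub_cancel, norm_sub_rev (xhat j t)] at h
  linarith [hr.norm_sub_xhat_le hs ht i, hr.norm_sub_xhat_le hs ht j,
    norm_sub_le_disagreement xhat t i j]

/-- The accumulated disagreement is controlled by the primal steps and the thresholds. -/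
lemma sum_disagreement_le (hs : StepSizes α β γ τ) (hN : N.Regular w B) (hw : 0 < w)
    (hw1 : w < 1) (hL : n * B ≠ 0) (T : ℕ) :
    ∑ t ∈ Icc 1 T, disagreement xhat t ≤ 2 * (n * B : ℕ) / w ^ (n * B) *
      (2 * R + ∑ t ∈ Icc 1 T, (∑ i, ‖x i (t + 1) - mixed N xhat i t‖ + τ (t + 1))) := by
  refine EventTriggered.sum_disagreement_le hN hw hw1 hL
    -- The deviation from pure averaging splits into the trigger error, at most `τ (t + 1)`, and the
    -- primal step.
    (δ := fun i t => xhat i (t + 1) - mixed N xhat i t) (fun i t _ => ?_) (fun i t ht => ?_)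
    (fun t ht i j => hP.norm_sub_le (hr.xhat_mem ht i) (hr.xhat_mem ht j)) T
  · rw [mixed]; abel
  · have h := norm_add_le (xhat i (t + 1) - x i (t + 1)) (x i (t + 1) - mixed N xhat i t)
    rw [sub_add_sub_cancel, norm_sub_rev (xhat i (t + 1)) (x i (t + 1))] at h
    have h1 := hr.norm_sub_xhat_le hs (t := t + 1) (by omega) i
    have h2 := Finset.single_le_sum (f := fun i => ‖x i (t + 1) - mixed N xhat i t‖)
      (fun _ _ => norm_nonneg _) (Finset.mem_univ i)
    linarith

end IsRun
end Run

/-! ### The concrete step sizes and the sums over all rounds. -/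

/-- The regularization parameter `β_t` of the dual update. -/
def dualReg (κ : ℝ) (t : ℕ) : ℝ := 1 / (t : ℝ) ^ κ

/-- The dual step size `γ_t`. -/
def dualStep (κ : ℝ) (t : ℕ) : ℝ := 1 / (t : ℝ) ^ (1 - κ)

lemma stepSizes {τ : ℕ → ℝ} {K κ : ℝ} (hτ : QuasiAntitone τ K) (hκ : 0 ≤ κ) :
    StepSizes (stepSize τ) (dualReg κ) (dualStep κ) τ where
  alpha_pos t ht := hτ.stepSize_pos ht
  beta_nonneg t _ := by unfold dualReg; positivity
  beta_anti t ht := by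
    have : (0 : ℝ) < t := by exact_mod_cast ht
    unfold dualReg
    push_cast
    gcongr
    linarith
  gamma_pos t ht := by
    have : (0 : ℝ) < t := by exact_mod_cast ht
    unfold dualStep; positivity
  beta_mul_gamma_le t ht := by
    have h0 : (0 : ℝ) < t := by exact_mod_cast ht
    have h1 : (1 : ℝ) ≤ t := by exact_mod_cast ht
    rw [dualReg, dualStep, one_div_mul_one_div, ← Real.rpow_add h0, add_sub_cancel,
      Real.rpow_one]
    exact (div_le_one h0).2 h1
  threshold_nonneg := hτ.nonneg

/-- Abel summation: `a t` acquires half the increment of the inverse dual step, which is at most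
`dualReg κ (t + 1) / 2`, so half of the regularization is left over. The final term is kept for the
violation bound. -/
lemma sum_dual_telescope_le {κ : ℝ} (hκ : 0 ≤ κ) {a : ℕ → ℝ} (ha : ∀ t, 1 ≤ t → 0 ≤ a t)
    (ha1 : a 1 = 0) (T : ℕ) :
    ∑ t ∈ Icc 1 T, ((a t - a (t + 1)) / (2 * dualStep κ (t + 1)) - dualReg κ (t + 1) * a t)
      ≤ -(1 / 2 * ∑ t ∈ Icc 1 T, dualReg κ (t + 1) * a t)
        - 1 / 2 * (a (T + 1) * ((T + 1 : ℕ) : ℝ) ^ (1 - κ)) := by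
  refine sum_Icc_le_of_step
    (b := fun T => -(1 / 2 * ∑ t ∈ Icc 1 T, dualReg κ (t + 1) * a t)
        - 1 / 2 * (a (T + 1) * ((T + 1 : ℕ) : ℝ) ^ (1 - κ))) (by simp [ha1]) (fun t => ?_) T
  rw [Finset.sum_Icc_succ_top (by omega)]
  have h1 := mul_le_mul_of_nonneg_left
    (rpow_one_sub_increment_le hκ (t := t + 1) (by omega)) (ha (t + 1) (by omega))
  have e : (a (t + 1) - a (t + 1 + 1)) / (2 * dualStep κ (t + 1 + 1))
      = (a (t + 1) - a (t + 1 + 1)) * ((t + 1 + 1 : ℕ) : ℝ) ^ (1 - κ) / 2 := by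
    rw [dualStep]; field_simp
  rw [e, dualReg]
  linarith

lemma weighted_sum_le {c₁ c₂ c₃ a b c : ℝ} (h₁ : 0 ≤ c₁) (h₂ : 0 ≤ c₂) (h₃ : 0 ≤ c₃)
    (ha : 0 ≤ a) (hb : 0 ≤ b) (hc : 0 ≤ c) :
    c₁ * a + c₂ * b + c₃ * c ≤ (c₁ + c₂ + c₃) * (a + b + c) := by
  have := mul_nonneg h₁ hb
  have := mul_nonneg h₁ hc
  have := mul_nonneg h₂ ha
  have := mul_nonneg h₂ hc
  have := mul_nonneg h₃ ha
  have := mul_nonneg h₃ hb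
  linarith

lemma sum_sum_const_left {n : ℕ} (a : ℕ → ℝ) (T : ℕ) :
    ∑ t ∈ Icc 1 T, ∑ _i : Fin n, a t = n * ∑ t ∈ Icc 1 T, a t := by
  simp [Finset.mul_sum]

/-- Total length of the primal steps `x_{i,t+1} - z_{i,t+1}`. -/
def totalStep {n p : ℕ} (N : Network n) (x xhat : Fin n → ℕ → E p) (T : ℕ) : ℝ :=
  ∑ t ∈ Icc 1 T, ∑ i, ‖x i (t + 1) - mixed N xhat i t‖

/-- Total energy of the primal steps, weighted by the inverse step sizes. -/
def totalEnergy {n p : ℕ} (N : Network n) (τ : ℕ → ℝ) (x xhat : Fin n → ℕ → E p) (T : ℕ) : ℝ :=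
  ∑ t ∈ Icc 1 T, ∑ i, ‖x i (t + 1) - mixed N xhat i t‖ ^ 2 / stepSize τ (t + 1)

section Bounds
variable {n p : ℕ} {m : Fin n → ℕ} {N : Network n} {τ : ℕ → ℝ} {K : ℝ}

lemma totalEnergy_nonneg (hτ : QuasiAntitone τ K) (N : Network n) (x xhat : Fin n → ℕ → E p)
    (T : ℕ) : 0 ≤ totalEnergy N τ x xhat T :=
  Finset.sum_nonneg fun _ _ => Finset.sum_nonneg fun _ _ =>
    div_nonneg (sq_nonneg _) (hτ.stepSize_pos (by omega)).le

/-- Termwise AM-GM in the form c r ≤ r²/(4α) + c²α: terms linear in the steps cost a quarter of the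
energy plus O(√(Ψ_T T)). -/
lemma mul_totalStep_le (hτ : QuasiAntitone τ K) (N : Network n) (x xhat : Fin n → ℕ → E p)
    {T : ℕ} (hT : 1 ≤ T) (c : ℝ) :
    c * totalStep N x xhat T ≤ totalEnergy N τ x xhat T / 4
      + c ^ 2 * n * (4 * √(2 * K)) * √(cumThreshold τ T * T) := by
  have h : c * totalStep N x xhat T ≤ totalEnergy N τ x xhat T / 4
      + c ^ 2 * ∑ t ∈ Icc 1 T, ∑ _i : Fin n, stepSize τ (t + 1) := by
    simp only [totalStep, totalEnergy, Finset.mul_sum, Finset.sum_div, ← Finset.sum_add_distrib]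
    refine Finset.sum_le_sum fun t _ => Finset.sum_le_sum fun i _ => ?_
    have ha := hτ.stepSize_pos (t := t + 1) (by omega)
    set r := ‖x i (t + 1) - mixed N xhat i t‖
    have e : r ^ 2 / stepSize τ (t + 1) / 4 + c ^ 2 * stepSize τ (t + 1) - c * r
        = (r / 2 - c * stepSize τ (t + 1)) ^ 2 / stepSize τ (t + 1) := by
      field_simp; ring
    have := div_nonneg (sq_nonneg (r / 2 - c * stepSize τ (t + 1))) ha.le
    linarith
  rw [sum_sum_const_left (fun t => stepSize τ (t + 1))] at h
  have h2 := mul_le_mul_of_nonneg_left (hτ.sum_stepSize_le hT)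
    (show 0 ≤ c ^ 2 * n by positivity)
  linarith

/-- Cauchy-Schwarz with weights α, for the violation bound, where the energy is known only to be
O(T). -/
lemma totalStep_sq_le (hτ : QuasiAntitone τ K) (N : Network n) (x xhat : Fin n → ℕ → E p)
    {T : ℕ} (hT : 1 ≤ T) :
    totalStep N x xhat T ^ 2 ≤ n * (4 * √(2 * K)) * √(cumThreshold τ T * T)
      * totalEnergy N τ x xhat T := by
  have h : totalStep N x xhat T ^ 2
      ≤ (∑ t ∈ Icc 1 T, ∑ _i : Fin n, stepSize τ (t + 1)) * totalEnergy N τ x xhat T := by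
    simp only [totalStep, totalEnergy, ← Finset.sum_product']
    refine Finset.sum_sq_le_sum_mul_sum_of_sq_le_mul _
      (fun t _ => (hτ.stepSize_pos (by omega)).le)
      (fun t _ => div_nonneg (sq_nonneg _) (hτ.stepSize_pos (by omega)).le) fun t _ => ?_
    have ha := hτ.stepSize_pos (t := t.1 + 1) (by omega)
    exact (mul_div_cancel₀ _ ha.ne').ge
  rw [sum_sum_const_left (fun t => stepSize τ (t + 1))] at h
  refine h.trans (mul_le_mul_of_nonneg_right ?_ (totalEnergy_nonneg hτ N x xhat T))
  have h2 := mul_le_mul_of_nonneg_left (hτ.sum_stepSize_le hT) (show (0 : ℝ) ≤ n by positivity)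
  linarith

variable {P : Problem n p m} {R F₁ F₂ w κ : ℝ} {B : ℕ}
  {x xhat : Fin n → ℕ → E p} {q : (i : Fin n) → ℕ → E (m i)}
  {D : (i : Fin n) → ℕ → (E p →L[ℝ] E (m i))}

namespace IsRun

variable (hr : IsRun P N (stepSize τ) (dualReg κ) (dualStep κ) τ x xhat q D)
  (hP : P.Regular R F₁ F₂) (hN : N.Regular w B) (hτ : QuasiAntitone τ K)
include hr hP hN hτ

lemma sum_disagreement_le_totalStep (hκ : 0 ≤ κ) (hw : 0 < w) (hw1 : w < 1) (hL : n * B ≠ 0)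
    {T : ℕ} (hT : 1 ≤ T) :
    ∑ t ∈ Icc 1 T, disagreement xhat t ≤ 2 * (n * B : ℕ) / w ^ (n * B) *
      (2 * R + totalStep N x xhat T + K * √(K * τ 1) * √(cumThreshold τ T * T)) := by
  refine (hr.sum_disagreement_le hP (stepSizes hτ hκ) hN hw hw1 hL T).trans ?_
  rw [Finset.sum_add_distrib, totalStep, add_assoc]
  gcongr
  refine (hτ.sum_succ_le T).trans ?_
  have hK := hτ.one_le
  rw [mul_assoc]
  gcongr
  exact hτ.cum_le_sqrt hT

omit hP in
lemma sum_norm_sub_succ_le (hκ : 0 ≤ κ) (T : ℕ) :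
    ∑ t ∈ Icc 1 T, ∑ i, ‖x i t - x i (t + 1)‖
      ≤ n * cumThreshold τ T + n * ∑ t ∈ Icc 1 T, disagreement xhat t
        + totalStep N x xhat T := by
  rw [cumThreshold, ← sum_sum_const_left, ← sum_sum_const_left, totalStep]
  simp only [← Finset.sum_add_distrib]
  exact Finset.sum_le_sum fun t ht => Finset.sum_le_sum fun i _ =>
    hr.norm_sub_succ_le (stepSizes hτ hκ) hN (Finset.mem_Icc.1 ht).1 i

lemma sum_primal_le (hκ : 0 ≤ κ) {T : ℕ} (hT : 1 ≤ T) {y : ℕ → E p}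
    (hy : ∀ t ∈ Icc 1 T, y t ∈ P.X) (hR : 0 ≤ R) :
    ∑ t ∈ Icc 1 T, ∑ i, (‖mixed N xhat i t - y t‖ ^ 2 - ‖x i (t + 1) - y t‖ ^ 2
          - ‖x i (t + 1) - mixed N xhat i t‖ ^ 2) / (2 * stepSize τ (t + 1))
      ≤ (4 * n * R ^ 2 / τ 1 + 8 * n * R) * √(cumThreshold τ T * T)
        + 2 * n * R * √K * (√((cumThreshold τ T)⁻¹ * T) * pathLength y T)
        - totalEnergy N τ x xhat T / 2 := by
  have hs := stepSizes hτ hκ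
  have h1 : ∑ t ∈ Icc 1 T, ∑ i, (‖mixed N xhat i t - y t‖ ^ 2 - ‖x i (t + 1) - y t‖ ^ 2
          - ‖x i (t + 1) - mixed N xhat i t‖ ^ 2) / (2 * stepSize τ (t + 1))
      ≤ ∑ t ∈ Icc 1 T, (1 / 2 * ∑ i, (‖x i t - y t‖ ^ 2 - ‖x i (t + 1) - y t‖ ^ 2)
          / stepSize τ (t + 1) + 2 * R * n * (τ t / stepSize τ (t + 1))
          - 1 / 2 * ∑ i, ‖x i (t + 1) - mixed N xhat i t‖ ^ 2 / stepSize τ (t + 1)) := by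
    refine Finset.sum_le_sum fun t ht => ?_
    have ht1 := (Finset.mem_Icc.1 ht).1
    have ha := hτ.stepSize_pos (t := t + 1) (by omega)
    have hsq : ∑ i, ‖mixed N xhat i t - y t‖ ^ 2
        ≤ ∑ i, ‖x i t - y t‖ ^ 2 + n * (4 * R * τ t) := by
      refine (hN.sum_norm_mixed_sub_sq_le ht1 xhat (y t)).trans ((Finset.sum_le_sum
        fun i _ => hr.norm_xhat_sub_sq_le hP hs ht1 i (hy t ht)).trans (le_of_eq ?_))
      simp [Finset.sum_add_distrib]
    simp only [← Finset.sum_div, Finset.sum_sub_distrib]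
    generalize ∑ i, ‖mixed N xhat i t - y t‖ ^ 2 = a at hsq ⊢
    generalize ∑ i, ‖x i t - y t‖ ^ 2 = b at hsq ⊢
    generalize ∑ i, ‖x i (t + 1) - y t‖ ^ 2 = b'
    generalize ∑ i, ‖x i (t + 1) - mixed N xhat i t‖ ^ 2 = c
    have e : 1 / 2 * ((b - b') / stepSize τ (t + 1)) + 2 * R * n * (τ t / stepSize τ (t + 1))
        - 1 / 2 * (c / stepSize τ (t + 1))
        = (b + n * (4 * R * τ t) - b' - c) / (2 * stepSize τ (t + 1)) := by
      field_simp; ring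
    rw [e]
    gcongr
  -- Moving the comparator from `y t` to `y (t + 1)` changes the squared distance by at most `4 * R`
  -- times the displacement, since both distances are at most `2 * R`.
  have h2 : ∀ i, ∑ t ∈ Icc 1 T, (‖x i t - y t‖ ^ 2 - ‖x i (t + 1) - y t‖ ^ 2)
          / stepSize τ (t + 1)
      ≤ (2 * R) ^ 2 * (2 / τ 1 * √(cumThreshold τ T * T))
        + √K * √((cumThreshold τ T)⁻¹ * T) * ∑ t ∈ Ico 1 T, 4 * R * ‖y (t + 1) - y t‖ := by
    intro i
    refine hτ.sum_telescope_le (D := fun t => ‖x i t - y t‖ ^ 2)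
      (D' := fun t => ‖x i (t + 1) - y t‖ ^ 2) hT (fun t ht1 ht2 => ⟨by positivity, ?_⟩)
      (fun _ _ => by positivity) (fun _ _ => by positivity) fun t ht1 ht2 => ?_
    · exact pow_le_pow_left₀ (norm_nonneg _)
        (hP.norm_sub_le (hr.x_mem ht1 i) (hy t (Finset.mem_Icc.2 ⟨ht1, ht2⟩))) 2
    · have g1 := hP.norm_sub_le (hr.x_mem (t := t + 1) (by omega) i)
        (hy t (Finset.mem_Icc.2 ⟨ht1, ht2.le⟩))
      have g2 := hP.norm_sub_le (hr.x_mem (t := t + 1) (by omega) i)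
        (hy (t + 1) (Finset.mem_Icc.2 ⟨by omega, ht2⟩))
      have g3 : ‖x i (t + 1) - y (t + 1)‖ ≤ ‖x i (t + 1) - y t‖ + ‖y (t + 1) - y t‖ := by
        have := norm_add_le (x i (t + 1) - y t) (y t - y (t + 1))
        rwa [sub_add_sub_cancel, norm_sub_rev (y t)] at this
      have g4 := norm_nonneg (y (t + 1) - y t)
      nlinarith [norm_nonneg (x i (t + 1) - y (t + 1)), norm_nonneg (x i (t + 1) - y t)]
  have h3 := Finset.sum_le_sum fun i (_ : i ∈ (univ : Finset (Fin n))) => h2 i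
  rw [Finset.sum_comm] at h3
  simp only [Finset.sum_const, Finset.card_univ, Fintype.card_fin, nsmul_eq_mul,
    ← Finset.mul_sum] at h3
  have h4 := mul_le_mul_of_nonneg_left (hτ.sum_div_stepSize_le hT)
    (show (0 : ℝ) ≤ 2 * R * n by positivity)
  refine h1.trans ?_
  rw [Finset.sum_sub_distrib, Finset.sum_add_distrib, ← Finset.mul_sum, ← Finset.mul_sum,
    ← Finset.mul_sum, totalEnergy, pathLength, show 4 * n * R ^ 2 / τ 1
    = 4 * n * R ^ 2 * (1 / τ 1) by rw [mul_one_div]]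
  rw [show 2 / τ 1 = 2 * (1 / τ 1) by rw [mul_one_div]] at h3
  linarith

omit hP hN hτ in
lemma sum_dual_le (hκ : 0 < κ) (hκ1 : κ < 1) {T : ℕ} (hT : 1 ≤ T) :
    ∑ t ∈ Icc 1 T, ∑ i, ((‖q i t‖ ^ 2 - ‖q i (t + 1)‖ ^ 2) / (2 * dualStep κ (t + 1))
        - dualReg κ (t + 1) * ‖q i t‖ ^ 2
        + 2 * (F₁ + 2 * R * F₂) ^ 2 * dualStep κ (t + 1))
      ≤ 4 * n * (F₁ + 2 * R * F₂) ^ 2 / κ * (T : ℝ) ^ κ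
        - 1 / 2 * ∑ i, ∑ t ∈ Icc 1 T, dualReg κ (t + 1) * ‖q i t‖ ^ 2
        - 1 / 2 * ∑ i, ‖q i (T + 1)‖ ^ 2 * ((T + 1 : ℕ) : ℝ) ^ (1 - κ) := by
  rw [Finset.sum_comm]
  have h1 : ∀ i, ∑ t ∈ Icc 1 T, ((‖q i t‖ ^ 2 - ‖q i (t + 1)‖ ^ 2) / (2 * dualStep κ (t + 1))
        - dualReg κ (t + 1) * ‖q i t‖ ^ 2
        + 2 * (F₁ + 2 * R * F₂) ^ 2 * dualStep κ (t + 1))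
      ≤ -(1 / 2 * ∑ t ∈ Icc 1 T, dualReg κ (t + 1) * ‖q i t‖ ^ 2)
        - 1 / 2 * (‖q i (T + 1)‖ ^ 2 * ((T + 1 : ℕ) : ℝ) ^ (1 - κ))
        + 2 * (F₁ + 2 * R * F₂) ^ 2 * (2 / κ * (T : ℝ) ^ κ) := by
    intro i
    rw [Finset.sum_add_distrib, ← Finset.mul_sum]
    refine add_le_add (sum_dual_telescope_le hκ.le (a := fun t => ‖q i t‖ ^ 2)
      (fun _ _ => by positivity) (by simp [hr.init_q]) T)
      (mul_le_mul_of_nonneg_left ?_ (by positivity))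
    exact sum_one_div_rpow_le hκ hκ1.le hT
  refine (Finset.sum_le_sum fun i _ => h1 i).trans (le_of_eq ?_)
  simp only [Finset.sum_add_distrib, Finset.sum_sub_distrib, Finset.sum_neg_distrib,
    ← Finset.mul_sum, Finset.sum_const, Finset.card_univ, Fintype.card_fin, nsmul_eq_mul]
  ring

end IsRun
end Bounds

/-! ### Regret and violation expressed through the residual. -/

section
variable {n p : ℕ} {m : Fin n → ℕ}

lemma norm_plus_globalConstraint_le (P : Problem n p m) (t : ℕ) (a : E p) :
    ‖plus (P.globalConstraint t a)‖ ≤ ∑ j, ‖plus (P.g j t a)‖ := by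
  have h : ‖plus (P.globalConstraint t a)‖ ^ 2 = ∑ j, ‖plus (P.g j t a)‖ ^ 2 := by
    simp only [EuclideanSpace.norm_sq_eq]
    rw [Fintype.sum_sigma]
    rfl
  apply le_of_sq_le_sq _ (Finset.sum_nonneg fun _ _ => norm_nonneg _)
  rw [h]
  exact Finset.sum_sq_le_sq_sum_of_nonneg fun _ _ => norm_nonneg _

lemma pathLength_nonneg (y : ℕ → E p) (T : ℕ) : 0 ≤ pathLength y T :=
  Finset.sum_nonneg fun _ _ => norm_nonneg _

variable {N : Network n} {τ : ℕ → ℝ} {K : ℝ}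
  {P : Problem n p m} {R F₁ F₂ w κ : ℝ} {B : ℕ}
  {x xhat : Fin n → ℕ → E p} {q : (i : Fin n) → ℕ → E (m i)}
  {D : (i : Fin n) → ℕ → (E p →L[ℝ] E (m i))}

/-- The nonnegative terms left over in the regret bound; they control the constraint violation. -/
def residual (N : Network n) (τ : ℕ → ℝ) (κ : ℝ) (x xhat : Fin n → ℕ → E p)
    (q : (i : Fin n) → ℕ → E (m i)) (T : ℕ) : ℝ :=
  totalEnergy N τ x xhat T / 4
    + 1 / 2 * ∑ i, ∑ t ∈ Icc 1 T, dualReg κ (t + 1) * ‖q i t‖ ^ 2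
    + 1 / 2 * ∑ i, ‖q i (T + 1)‖ ^ 2 * ((T + 1 : ℕ) : ℝ) ^ (1 - κ)

lemma dual_energy_nonneg (q : (i : Fin n) → ℕ → E (m i)) (κ : ℝ) (T : ℕ) (i : Fin n) :
    0 ≤ ∑ t ∈ Icc 1 T, dualReg κ (t + 1) * ‖q i t‖ ^ 2 :=
  Finset.sum_nonneg fun t _ => mul_nonneg (by unfold dualReg; positivity) (by positivity)

lemma dual_final_nonneg (q : (i : Fin n) → ℕ → E (m i)) (κ : ℝ) (T : ℕ) (i : Fin n) :
    0 ≤ ‖q i (T + 1)‖ ^ 2 * ((T + 1 : ℕ) : ℝ) ^ (1 - κ) := by positivity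

lemma totalEnergy_le_residual (N : Network n) (τ : ℕ → ℝ) (κ : ℝ) (x xhat : Fin n → ℕ → E p)
    (q : (i : Fin n) → ℕ → E (m i)) (T : ℕ) :
    totalEnergy N τ x xhat T / 4 ≤ residual N τ κ x xhat q T := by
  have h1 := Finset.sum_nonneg fun i (_ : i ∈ univ) => dual_energy_nonneg q κ T i
  have h2 := Finset.sum_nonneg fun i (_ : i ∈ univ) => dual_final_nonneg q κ T i
  unfold residual
  linarith

lemma dual_energy_le_residual (hτ : QuasiAntitone τ K) (N : Network n) (κ : ℝ)
    (x xhat : Fin n → ℕ → E p) (q : (i : Fin n) → ℕ → E (m i)) (T : ℕ) (i : Fin n) :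
    ∑ t ∈ Icc 1 T, dualReg κ (t + 1) * ‖q i t‖ ^ 2 ≤ 2 * residual N τ κ x xhat q T := by
  have h0 := totalEnergy_nonneg hτ N x xhat T
  have h1 := Finset.single_le_sum (f := fun i => ∑ t ∈ Icc 1 T, dualReg κ (t + 1) * ‖q i t‖ ^ 2)
    (fun i _ => dual_energy_nonneg q κ T i) (Finset.mem_univ i)
  have h2 := Finset.sum_nonneg fun i (_ : i ∈ univ) => dual_final_nonneg q κ T i
  unfold residual
  linarith

lemma dual_final_le_residual (hτ : QuasiAntitone τ K) (N : Network n) (κ : ℝ)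
    (x xhat : Fin n → ℕ → E p) (q : (i : Fin n) → ℕ → E (m i)) (T : ℕ) (i : Fin n) :
    ‖q i (T + 1)‖ ^ 2 * ((T + 1 : ℕ) : ℝ) ^ (1 - κ) ≤ 2 * residual N τ κ x xhat q T := by
  have h0 := totalEnergy_nonneg hτ N x xhat T
  have h1 := Finset.sum_nonneg fun i (_ : i ∈ univ) => dual_energy_nonneg q κ T i
  have h2 := Finset.single_le_sum
    (f := fun i => ‖q i (T + 1)‖ ^ 2 * ((T + 1 : ℕ) : ℝ) ^ (1 - κ))
    (fun i _ => dual_final_nonneg q κ T i) (Finset.mem_univ i)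
  unfold residual
  linarith

lemma one_le_rpow_natCast {T : ℕ} (hT : 1 ≤ T) {a : ℝ} (ha : 0 ≤ a) : 1 ≤ (T : ℝ) ^ a :=
  Real.one_le_rpow (by exact_mod_cast hT) ha

/-- Source of the exponent 1 - κ/2: the residual contributes T, and ∑β or 1/γ_{T+1} contributes
T^{1-κ}, under a square root. -/
lemma mul_rpow_one_sub {t : ℝ} (ht : 0 < t) (κ : ℝ) :
    t * t ^ (1 - κ) = (t ^ (1 - κ / 2)) ^ 2 := by
  rw [← Real.rpow_natCast, ← Real.rpow_mul ht.le]
  nth_rewrite 1 [← Real.rpow_one t]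
  rw [← Real.rpow_add ht]
  congr 1
  push_cast; ring

/-- The constant of the consensus bound. -/
def mixConst (n B : ℕ) (w : ℝ) : ℝ := 2 * (n * B : ℕ) / w ^ (n * B)

lemma mixConst_nonneg (n B : ℕ) {w : ℝ} (hw : 0 < w) : 0 ≤ mixConst n B w := by
  unfold mixConst; positivity

/-- The constant in the bound on the regret of the agents for their own losses. -/
def regretConst (n B : ℕ) (R F₁ F₂ w κ τ₁ K : ℝ) : ℝ :=
  (2 * n * F₂ * mixConst n B w * R + 4 * n * (F₁ + 2 * R * F₂) ^ 2 / κ)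
  + (F₂ * n * √(K * τ₁) + F₂ * n * mixConst n B w * K * √(K * τ₁)
    + (F₂ * n * mixConst n B w + F₂) ^ 2 * n * (4 * √(2 * K))
    + (4 * n * R ^ 2 / τ₁ + 8 * n * R))
  + 2 * n * R * √K

lemma regretConst_nonneg (n B : ℕ) {R F₁ F₂ w κ τ₁ K : ℝ} (hR : 0 ≤ R) (hF₂ : 0 ≤ F₂)
    (hw : 0 < w) (hκ : 0 < κ) (hτ₁ : 0 < τ₁) (hK : 0 ≤ K) :
    0 ≤ regretConst n B R F₁ F₂ w κ τ₁ K := by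
  have := mixConst_nonneg n B hw
  unfold regretConst
  positivity

namespace IsRun

variable (hr : IsRun P N (stepSize τ) (dualReg κ) (dualStep κ) τ x xhat q D)
  (hP : P.Regular R F₁ F₂) (hN : N.Regular w B) (hτ : QuasiAntitone τ K)
include hr hP hN hτ

lemma sum_loss_add_residual_le (hR : 0 ≤ R) (hF₂ : 0 ≤ F₂) (hκ : 0 < κ) (hκ1 : κ < 1)
    (hw : 0 < w) (hw1 : w < 1) (hL : n * B ≠ 0) {T : ℕ} (hT : 1 ≤ T) {y : ℕ → E p}
    (hy : y ∈ P.feasible T) :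
    ∑ t ∈ Icc 1 T, ∑ i, (P.f i t (x i t) - P.f i t (y t)) + residual N τ κ x xhat q T
      ≤ regretConst n B R F₁ F₂ w κ (τ 1) K * ((T : ℝ) ^ κ + √(cumThreshold τ T * T)
            + √((cumThreshold τ T)⁻¹ * T) * pathLength y T) := by
  have hs := stepSizes hτ hκ.le
  have hK := hτ.one_le
  have hτ1 := hτ.one_pos
  have hc := mixConst_nonneg n B hw
  have h1 : ∑ t ∈ Icc 1 T, ∑ i, (P.f i t (x i t) - P.f i t (y t))
      ≤ ∑ t ∈ Icc 1 T, ∑ i, (F₂ * ‖x i t - x i (t + 1)‖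
      + (‖mixed N xhat i t - y t‖ ^ 2 - ‖x i (t + 1) - y t‖ ^ 2
          - ‖x i (t + 1) - mixed N xhat i t‖ ^ 2) / (2 * stepSize τ (t + 1))
      + ((‖q i t‖ ^ 2 - ‖q i (t + 1)‖ ^ 2) / (2 * dualStep κ (t + 1))
        - dualReg κ (t + 1) * ‖q i t‖ ^ 2
        + 2 * (F₁ + 2 * R * F₂) ^ 2 * dualStep κ (t + 1))) :=
    Finset.sum_le_sum fun t ht => Finset.sum_le_sum fun i _ =>
      hr.loss_sub_le hP hs hF₂ (Finset.mem_Icc.1 ht).1 i (hy t ht).1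
        fun k => (hy t ht).2 ⟨i, k⟩
  simp only [Finset.sum_add_distrib (f := fun i => F₂ * ‖x i _ - x i (_ + 1)‖ + _),
    Finset.sum_add_distrib (f := fun i => F₂ * ‖x i _ - x i (_ + 1)‖)] at h1
  rw [Finset.sum_add_distrib, Finset.sum_add_distrib] at h1
  simp only [← Finset.mul_sum (a := F₂)] at h1
  have h2 := mul_le_mul_of_nonneg_left (hr.sum_norm_sub_succ_le hN hτ hκ.le T) hF₂
  have h3 := mul_le_mul_of_nonneg_left
    (hr.sum_disagreement_le_totalStep hP hN hτ hκ.le hw hw1 hL hT)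
    (show 0 ≤ F₂ * n by positivity)
  have h4 := hr.sum_primal_le hP hN hτ hκ.le hT (fun t ht => (hy t ht).1) hR
  have h5 := hr.sum_dual_le (F₁ := F₁) (F₂ := F₂) (R := R) hκ hκ1 hT
  -- The movement contains the primal steps once directly and once through the disagreement.
  -- Absorbing both uses half of the available energy; the other half stays in `residual`.
  have h6 := mul_totalStep_le hτ N x xhat hT (F₂ * n * mixConst n B w + F₂)
  have h7 := mul_le_mul_of_nonneg_left (hτ.cum_le_sqrt hT) (show 0 ≤ F₂ * n by positivity)
  have h8 := mul_le_mul_of_nonneg_left (one_le_rpow_natCast hT hκ.le)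
    (show 0 ≤ 2 * n * F₂ * mixConst n B w * R by positivity)
  rw [← mixConst] at h3
  have hp := pathLength_nonneg y T
  have h9 := weighted_sum_le
    (c₁ := 2 * n * F₂ * mixConst n B w * R + 4 * n * (F₁ + 2 * R * F₂) ^ 2 / κ)
    (c₂ := F₂ * n * √(K * τ 1) + F₂ * n * mixConst n B w * K * √(K * τ 1)
      + (F₂ * n * mixConst n B w + F₂) ^ 2 * n * (4 * √(2 * K))
      + (4 * n * R ^ 2 / τ 1 + 8 * n * R)) (c₃ := 2 * n * R * √K)
    (a := (T : ℝ) ^ κ) (b := √(cumThreshold τ T * T))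
    (c := √((cumThreshold τ T)⁻¹ * T) * pathLength y T)
    (by positivity) (by positivity) (by positivity) (by positivity) (by positivity)
    (by positivity)
  refine le_trans ?_ h9
  unfold residual
  linarith

omit hN in
-- Evaluating every f_j at x_i instead of x_j costs F₂ times the distance of the agents, so only
-- own-loss regret and consensus error remain.
lemma netReg_le (hF₂ : 0 ≤ F₂) (hκ : 0 ≤ κ) (hn : 0 < n) (T : ℕ) {y : ℕ → E p} :
    n * P.netReg x y T ≤ ∑ t ∈ Icc 1 T, ∑ i, (P.f i t (x i t) - P.f i t (y t))
      + n * F₂ * (∑ t ∈ Icc 1 T, disagreement xhat t + 2 * cumThreshold τ T) := by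
  have hs := stepSizes hτ hκ
  have hn' : (0 : ℝ) < n := by exact_mod_cast hn
  have h1 : ∑ i, ∑ t ∈ Icc 1 T, n * P.globalLoss t (x i t)
      ≤ ∑ _i : Fin n, ∑ t ∈ Icc 1 T, (∑ j, P.f j t (x j t)
        + n * (F₂ * (disagreement xhat t + 2 * τ t))) := by
    refine Finset.sum_le_sum fun i _ => Finset.sum_le_sum fun t ht => ?_
    have ht1 := (Finset.mem_Icc.1 ht).1
    rw [Problem.globalLoss, ← mul_assoc, mul_one_div_cancel hn'.ne', one_mul]
    have e : (n : ℝ) * (F₂ * (disagreement xhat t + 2 * τ t))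
      = ∑ _j : Fin n, F₂ * (disagreement xhat t + 2 * τ t) := by simp
    rw [e, ← Finset.sum_add_distrib]
    refine Finset.sum_le_sum fun j _ => ?_
    have h2 := hP.loss_sub_le j ht1 (hr.x_mem ht1 i) (hr.x_mem ht1 j)
    have h3 := mul_le_mul_of_nonneg_left (hr.norm_sub_agents_le hs ht1 i j) hF₂
    linarith
  have h4 : ∑ t ∈ Icc 1 T, n * P.globalLoss t (y t) = ∑ t ∈ Icc 1 T, ∑ i, P.f i t (y t) :=
    Finset.sum_congr rfl fun t _ => by
      rw [Problem.globalLoss, ← mul_assoc, mul_one_div_cancel hn'.ne', one_mul]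
  simp only [Finset.sum_const, Finset.card_univ, Fintype.card_fin, nsmul_eq_mul,
    ← Finset.mul_sum, Finset.sum_add_distrib] at h1 h4
  have h5 := le_of_mul_le_mul_left h1 hn'
  simp only [Finset.sum_sub_distrib]
  rw [Problem.netReg, mul_sub, h4, ← mul_assoc, mul_one_div_cancel hn'.ne', one_mul, cumThreshold]
  linarith

omit hN in
lemma netCCV_le (hF₂ : 0 ≤ F₂) (hκ : 0 ≤ κ) (hn : 0 < n) (T : ℕ) :
    P.netCCV x T ≤ ∑ i, ∑ t ∈ Icc 1 T, ‖plus (P.g i t (x i t))‖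
      + n * F₂ * (∑ t ∈ Icc 1 T, disagreement xhat t + 2 * cumThreshold τ T) := by
  have hs := stepSizes hτ hκ
  have hn' : (0 : ℝ) < n := by exact_mod_cast hn
  have h1 : ∑ i, ∑ t ∈ Icc 1 T, ‖plus (P.globalConstraint t (x i t))‖
      ≤ ∑ _i : Fin n, ∑ t ∈ Icc 1 T, (∑ j, ‖plus (P.g j t (x j t))‖
        + n * (F₂ * (disagreement xhat t + 2 * τ t))) := by
    refine Finset.sum_le_sum fun i _ => Finset.sum_le_sum fun t ht => ?_
    have ht1 := (Finset.mem_Icc.1 ht).1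
    have e : (n : ℝ) * (F₂ * (disagreement xhat t + 2 * τ t))
      = ∑ _j : Fin n, F₂ * (disagreement xhat t + 2 * τ t) := by simp
    rw [e, ← Finset.sum_add_distrib]
    refine (norm_plus_globalConstraint_le P t (x i t)).trans (Finset.sum_le_sum fun j _ => ?_)
    have h2 := hP.norm_plus_constraint_le j ht1 (hr.x_mem ht1 i) (hr.x_mem ht1 j)
    have h3 := mul_le_mul_of_nonneg_left (hr.norm_sub_agents_le hs ht1 i j) hF₂
    linarith
  simp only [Finset.sum_const, Finset.card_univ, Fintype.card_fin, nsmul_eq_mul,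
    ← Finset.mul_sum, Finset.sum_add_distrib] at h1
  rw [Problem.netCCV, one_div, inv_mul_le_iff₀ hn',
    Finset.sum_comm (f := fun i t => ‖plus (P.g i t (x i t))‖), cumThreshold]
  linarith

omit hN hτ in
-- The dual update, divided by its step, bounds the violation by (q_{t+1} - q_t)/γ_{t+1} + β_{t+1}
-- q_t plus the movement. As 1/γ is nondecreasing, q ≥ 0 and q_1 = 0, the first part telescopes to
-- its final value.
lemma sum_plus_apply_le (hκ1 : κ ≤ 1) (T : ℕ) (i : Fin n) (k : Fin (m i)) :
    ∑ t ∈ Icc 1 T, plus (P.g i t (x i t)) k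
      ≤ ‖q i (T + 1)‖ * ((T + 1 : ℕ) : ℝ) ^ (1 - κ)
        + ∑ t ∈ Icc 1 T, dualReg κ (t + 1) * ‖q i t‖
        + F₂ * ∑ t ∈ Icc 1 T, ‖x i t - x i (t + 1)‖ := by
  have h1 : ∑ t ∈ Icc 1 T, plus (P.g i t (x i t)) k
      ≤ q i (T + 1) k * ((T + 1 : ℕ) : ℝ) ^ (1 - κ)
        + ∑ t ∈ Icc 1 T, dualReg κ (t + 1) * ‖q i t‖
        + F₂ * ∑ t ∈ Icc 1 T, ‖x i t - x i (t + 1)‖ := by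
    refine sum_Icc_le_of_step (a := fun t => plus (P.g i t (x i t)) k)
      (b := fun T => q i (T + 1) k * ((T + 1 : ℕ) : ℝ) ^ (1 - κ)
        + ∑ t ∈ Icc 1 T, dualReg κ (t + 1) * ‖q i t‖
        + F₂ * ∑ t ∈ Icc 1 T, ‖x i t - x i (t + 1)‖) (by simp [hr.init_q]) (fun s => ?_) T
    rw [Finset.sum_Icc_succ_top (by omega), Finset.sum_Icc_succ_top (by omega)]
    obtain ⟨t, ht⟩ : ∃ t, t = s + 1 := ⟨_, rfl⟩
    rw [← ht]
    have ht1 : 1 ≤ t := by omega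
    have hq := hr.dual_nonneg ht1 i k
    have hqn := (le_abs_self _).trans (abs_apply_le_norm (q i t) k)
    have hD := (neg_abs_le _).trans' (neg_le_neg ((abs_apply_le_norm
      (D i t (x i (t + 1) - x i t)) k).trans
        (hr.norm_gradient_apply_le hP ht1 i (x i (t + 1) - x i t))))
    rw [norm_sub_rev (x i (t + 1))] at hD
    have hb : dualDrift P x D i t k
      = plus (P.g i t (x i t)) k + D i t (x i (t + 1) - x i t) k := rfl
    have hdual : (1 - dualReg κ (t + 1) * dualStep κ (t + 1)) * q i t k
        + dualStep κ (t + 1) * dualDrift P x D i t k ≤ q i (t + 1) k := by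
      rw [hr.dual_eq ht1]
      exact le_max_left _ _
    set c := ((t + 1 : ℕ) : ℝ) ^ (1 - κ) with hc
    have hc0 : 0 < c := by positivity
    have hcg : c * dualStep κ (t + 1) = 1 := mul_one_div_cancel hc0.ne'
    have hct : (t : ℝ) ^ (1 - κ) ≤ c :=
      Real.rpow_le_rpow (by positivity) (by push_cast; linarith) (by linarith)
    have hβ : 0 ≤ dualReg κ (t + 1) := by unfold dualReg; positivity
    have e1 := mul_le_mul_of_nonneg_left hdual hc0.le
    have e2 : c * ((1 - dualReg κ (t + 1) * dualStep κ (t + 1)) * q i t k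
        + dualStep κ (t + 1) * dualDrift P x D i t k)
        = c * q i t k - (c * dualStep κ (t + 1)) * dualReg κ (t + 1) * q i t k
          + (c * dualStep κ (t + 1)) * dualDrift P x D i t k := by ring
    rw [e2, hcg] at e1
    have e3 := mul_le_mul_of_nonneg_left hct hq
    have e4 := mul_le_mul_of_nonneg_left hqn hβ
    linarith
  have h2 := (le_abs_self _).trans (abs_apply_le_norm (q i (T + 1)) k)
  have h3 : 0 ≤ ((T + 1 : ℕ) : ℝ) ^ (1 - κ) := by positivity
  linarith [mul_le_mul_of_nonneg_right h2 h3]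

omit hN hτ in
lemma sum_norm_plus_le (hκ1 : κ ≤ 1) (T : ℕ) (i : Fin n) :
    ∑ t ∈ Icc 1 T, ‖plus (P.g i t (x i t))‖
      ≤ m i * (‖q i (T + 1)‖ * ((T + 1 : ℕ) : ℝ) ^ (1 - κ)
        + ∑ t ∈ Icc 1 T, dualReg κ (t + 1) * ‖q i t‖
        + F₂ * ∑ t ∈ Icc 1 T, ‖x i t - x i (t + 1)‖) := by
  calc ∑ t ∈ Icc 1 T, ‖plus (P.g i t (x i t))‖
      ≤ ∑ t ∈ Icc 1 T, ∑ k, plus (P.g i t (x i t)) k := by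
        refine Finset.sum_le_sum fun t _ => (norm_le_sum_abs _).trans (le_of_eq ?_)
        exact Finset.sum_congr rfl fun k _ => abs_of_nonneg (plus_nonneg _ k)
    _ = ∑ k, ∑ t ∈ Icc 1 T, plus (P.g i t (x i t)) k := Finset.sum_comm
    _ ≤ _ := (Finset.sum_le_sum fun k _ => hr.sum_plus_apply_le hP hκ1 T i k).trans
        (le_of_eq (by
          rw [Finset.sum_const, Finset.card_univ, Fintype.card_fin, nsmul_eq_mul]))

omit hr hP hN in
-- The residual controls ‖q‖² times only one factor (T+1)^{1-κ}; the square of the left side has a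
-- second, which supplies the decay in κ.
lemma norm_dual_mul_le (hκ : 0 ≤ κ) (hκ1 : κ ≤ 1) {T : ℕ} (hT : 1 ≤ T) {C : ℝ} (hC : 0 ≤ C)
    (hres : residual N τ κ x xhat q T ≤ C * T) (i : Fin n) :
    ‖q i (T + 1)‖ * ((T + 1 : ℕ) : ℝ) ^ (1 - κ) ≤ 2 * √C * (T : ℝ) ^ (1 - κ / 2) := by
  have hT0 : (0 : ℝ) < T := by exact_mod_cast hT
  have h1 := dual_final_le_residual hτ N κ x xhat q T i
  have h2 := succ_rpow_le_two_mul (a := 1 - κ) (by linarith) (by linarith) hT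
  apply le_of_sq_le_sq _ (by positivity)
  have h3 : (0 : ℝ) ≤ ((T + 1 : ℕ) : ℝ) ^ (1 - κ) := by positivity
  calc (‖q i (T + 1)‖ * ((T + 1 : ℕ) : ℝ) ^ (1 - κ)) ^ 2
      = (‖q i (T + 1)‖ ^ 2 * ((T + 1 : ℕ) : ℝ) ^ (1 - κ)) * ((T + 1 : ℕ) : ℝ) ^ (1 - κ) := by
        ring
    _ ≤ (2 * (C * T)) * (2 * (T : ℝ) ^ (1 - κ)) :=
        mul_le_mul (h1.trans (by linarith)) h2 h3 (by positivity)
    _ = 4 * C * (T * (T : ℝ) ^ (1 - κ)) := by ring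
    _ = (2 * √C * (T : ℝ) ^ (1 - κ / 2)) ^ 2 := by
        rw [mul_rpow_one_sub hT0, mul_pow, mul_pow, Real.sq_sqrt hC]; norm_num

omit hr hP hN in
-- Cauchy-Schwarz with weights β, where ∑β = O(T^{1-κ}) and ∑β‖q‖² is at most twice the residual.
lemma sum_reg_mul_norm_dual_le (hκ : 0 ≤ κ) (hκ1 : κ < 1) {T : ℕ} (hT : 1 ≤ T) {C : ℝ}
    (hC : 0 ≤ C) (hres : residual N τ κ x xhat q T ≤ C * T) (i : Fin n) :
    ∑ t ∈ Icc 1 T, dualReg κ (t + 1) * ‖q i t‖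
      ≤ 2 * √(C / (1 - κ)) * (T : ℝ) ^ (1 - κ / 2) := by
  have hT0 : (0 : ℝ) < T := by exact_mod_cast hT
  have hk : 0 < 1 - κ := by linarith
  have h1 := dual_energy_le_residual hτ N κ x xhat q T i
  have h2 := sum_one_div_rpow_le hk (by linarith) hT
  rw [sub_sub_cancel] at h2
  have hβ : ∀ t, 0 ≤ dualReg κ (t + 1) := fun t => by unfold dualReg; positivity
  apply le_of_sq_le_sq _ (by positivity)
  calc (∑ t ∈ Icc 1 T, dualReg κ (t + 1) * ‖q i t‖) ^ 2
      ≤ (∑ t ∈ Icc 1 T, dualReg κ (t + 1)) * ∑ t ∈ Icc 1 T, dualReg κ (t + 1) * ‖q i t‖ ^ 2 :=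
        Finset.sum_sq_le_sum_mul_sum_of_sq_le_mul _ (fun t _ => hβ t)
          (fun t _ => mul_nonneg (hβ t) (sq_nonneg _)) fun t _ => le_of_eq (by ring)
    _ ≤ (2 / (1 - κ) * (T : ℝ) ^ (1 - κ)) * (2 * (C * T)) :=
        mul_le_mul h2 (h1.trans (by linarith)) (dual_energy_nonneg q κ T i) (by positivity)
    _ = 4 * (C / (1 - κ)) * (T * (T : ℝ) ^ (1 - κ)) := by ring
    _ = (2 * √(C / (1 - κ)) * (T : ℝ) ^ (1 - κ / 2)) ^ 2 := by
        rw [mul_rpow_one_sub hT0, mul_pow, mul_pow, Real.sq_sqrt (by positivity)]; norm_num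

end IsRun

lemma sqrt_sqrt_mul_eq {a t : ℝ} (ha : 0 ≤ a) (ht : 0 ≤ t) :
    √(√(a * t) * t) = (a * t ^ 3) ^ (1 / 4 : ℝ) := by
  have h : √(a * t) * t = √(a * t ^ 3) := by
    rw [show a * t ^ 3 = a * t * t ^ 2 by ring, Real.sqrt_mul (x := a * t) (by positivity),
      Real.sqrt_sq ht]
  rw [h, Real.sqrt_eq_rpow, Real.sqrt_eq_rpow, ← Real.rpow_mul (by positivity)]
  norm_num

lemma totalStep_le (hτ : QuasiAntitone τ K) {T : ℕ} (hT : 1 ≤ T) {C : ℝ} (hC : 0 ≤ C)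
    (hres : residual N τ κ x xhat q T ≤ C * T) :
    totalStep N x xhat T
      ≤ √(16 * n * √(2 * K) * C) * (cumThreshold τ T * (T : ℝ) ^ 3) ^ (1 / 4 : ℝ) := by
  have h1 := totalEnergy_le_residual N τ κ x xhat q T
  have h2 := totalStep_sq_le hτ N x xhat hT
  rw [← sqrt_sqrt_mul_eq (hτ.cum_nonneg T) (by positivity), ← Real.sqrt_mul (by positivity)]
  apply Real.le_sqrt_of_sq_le
  refine h2.trans ?_
  have h3 : totalEnergy N τ x xhat T ≤ 4 * (C * T) := by linarith
  refine (mul_le_mul_of_nonneg_left h3 (by positivity)).trans (le_of_eq (by ring))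

lemma QuasiAntitone.sqrt_cum_le_rpow (hτ : QuasiAntitone τ K) {T : ℕ} (hT : 1 ≤ T) :
    √(cumThreshold τ T * T)
      ≤ √(√(K * τ 1)) * (cumThreshold τ T * (T : ℝ) ^ 3) ^ (1 / 4 : ℝ) := by
  rw [← sqrt_sqrt_mul_eq (hτ.cum_nonneg T) (by positivity), ← Real.sqrt_mul (by positivity)]
  apply Real.le_sqrt_of_sq_le
  have h := hτ.sqrt_cum_mul_le hT
  have h0 := Real.sqrt_nonneg (cumThreshold τ T * T)
  nlinarith [mul_le_mul_of_nonneg_left h h0]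

end

/-! ### Explicit constants for both bounds. -/

section
variable {n p : ℕ} {m : Fin n → ℕ} {N : Network n} {τ : ℕ → ℝ} {K : ℝ}
  {P : Problem n p m} {R F₁ F₂ w κ : ℝ} {B : ℕ}
  {x xhat : Fin n → ℕ → E p} {q : (i : Fin n) → ℕ → E (m i)}
  {D : (i : Fin n) → ℕ → (E p →L[ℝ] E (m i))}

namespace IsRun
variable (hr : IsRun P N (stepSize τ) (dualReg κ) (dualStep κ) τ x xhat q D)
  (hP : P.Regular R F₁ F₂) (hN : N.Regular w B) (hτ : QuasiAntitone τ K)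
include hr hP hN hτ

lemma netReg_bound (hn : 0 < n) (hR : 0 ≤ R) (hF₂ : 0 ≤ F₂) (hκ : 0 < κ) (hκ1 : κ < 1)
    (hw : 0 < w) (hw1 : w < 1) (hB : B ≠ 0) {T : ℕ} (hT : 1 ≤ T) {y : ℕ → E p}
    (hy : y ∈ P.feasible T) :
    n * P.netReg x y T ≤ (regretConst n B R F₁ F₂ w κ (τ 1) K
        + (2 * n * F₂ * mixConst n B w * R
          + (n * F₂ * mixConst n B w * K * √(K * τ 1) + 2 * n * F₂ * √(K * τ 1)
            + (n * F₂ * mixConst n B w) ^ 2 * n * (4 * √(2 * K))) + 0))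
      * ((T : ℝ) ^ κ + √(cumThreshold τ T * T)
            + √((cumThreshold τ T)⁻¹ * T) * pathLength y T) := by
  have hL : n * B ≠ 0 := Nat.mul_ne_zero hn.ne' hB
  have hK := hτ.one_le
  have hc := mixConst_nonneg n B hw
  have hp := pathLength_nonneg y T
  have h1 := hr.sum_loss_add_residual_le hP hN hτ hR hF₂ hκ hκ1 hw hw1 hL hT hy
  have h2 := hr.netReg_le hP hτ hF₂ hκ.le hn T (y := y)
  have h3 := mul_le_mul_of_nonneg_left
    (hr.sum_disagreement_le_totalStep hP hN hτ hκ.le hw hw1 hL hT)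
    (show 0 ≤ n * F₂ by positivity)
  -- The consensus error again contains the primal steps; the quarter of the energy kept in
  -- `residual` pays for them.
  have h4 := mul_totalStep_le hτ N x xhat hT (n * F₂ * mixConst n B w)
  have h5 := totalEnergy_le_residual N τ κ x xhat q T
  have h6 := mul_le_mul_of_nonneg_left (hτ.cum_le_sqrt hT) (show 0 ≤ 2 * n * F₂ by positivity)
  have h7 := mul_le_mul_of_nonneg_left (one_le_rpow_natCast hT hκ.le)
    (show 0 ≤ 2 * n * F₂ * mixConst n B w * R by positivity)
  rw [← mixConst] at h3
  have h8 := weighted_sum_le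
    (c₁ := 2 * n * F₂ * mixConst n B w * R)
    (c₂ := n * F₂ * mixConst n B w * K * √(K * τ 1) + 2 * n * F₂ * √(K * τ 1)
            + (n * F₂ * mixConst n B w) ^ 2 * n * (4 * √(2 * K))) (c₃ := 0)
    (a := (T : ℝ) ^ κ) (b := √(cumThreshold τ T * T))
    (c := √((cumThreshold τ T)⁻¹ * T) * pathLength y T)
    (by positivity) (by positivity) le_rfl (by positivity) (by positivity) (by positivity)
  rw [add_mul (regretConst n B R F₁ F₂ w κ (τ 1) K)]
  refine le_trans ?_ (add_le_add h1 h8)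
  linarith

/-- A static comparator has zero path length, and the own-loss regret cannot fall below `-(n * F₁ *
T)`; what remains of the regret estimate bounds the residual linearly in `T`. -/
lemma residual_le (hn : 0 < n) (hR : 0 ≤ R) (hF₂ : 0 ≤ F₂) (hκ : 0 < κ) (hκ1 : κ < 1)
    (hw : 0 < w) (hw1 : w < 1) (hB : B ≠ 0) {T : ℕ} (hT : 1 ≤ T)
    (hfeas : (P.staticFeasible T).Nonempty) :
    residual N τ κ x xhat q T
      ≤ (regretConst n B R F₁ F₂ w κ (τ 1) K * (1 + √(K * τ 1)) + n * F₁) * T := by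
  obtain ⟨y, hy, hyX⟩ := hfeas
  have h1 := hr.sum_loss_add_residual_le hP hN hτ hR hF₂ hκ hκ1 hw hw1
    (Nat.mul_ne_zero hn.ne' hB) hT hy
  have h2 : -(n * F₁ * T) ≤ ∑ t ∈ Icc 1 T, ∑ i, (P.f i t (x i t) - P.f i t y) := by
    calc -(n * F₁ * T) = ∑ t ∈ Icc 1 T, ∑ _i : Fin n, -F₁ := by simp; ring
      _ ≤ _ := Finset.sum_le_sum fun t ht => Finset.sum_le_sum fun i _ =>
        (abs_le.1 (hP.loss_bound i t (Finset.mem_Icc.1 ht).1 _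
          (hr.x_mem (Finset.mem_Icc.1 ht).1 i) y hyX)).1
  have h3 : pathLength (fun _ => y) T = 0 := by simp [pathLength]
  have hC := regretConst_nonneg n B (F₁ := F₁) hR hF₂ hw hκ hτ.one_pos
    (zero_le_one.trans hτ.one_le)
  have hT1 : (1 : ℝ) ≤ T := by exact_mod_cast hT
  have h4 : (T : ℝ) ^ κ ≤ T := by
    calc (T : ℝ) ^ κ ≤ (T : ℝ) ^ (1 : ℝ) := Real.rpow_le_rpow_of_exponent_le hT1 hκ1.le
      _ = T := Real.rpow_one _
  have h5 := mul_le_mul_of_nonneg_left (add_le_add h4 (hτ.sqrt_cum_mul_le hT)) hC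
  rw [h3, mul_zero, add_zero] at h1
  linarith

lemma netCCV_bound (hn : 0 < n) (hR : 0 ≤ R) (hF₂ : 0 ≤ F₂) (hκ : 0 < κ) (hκ1 : κ < 1)
    (hw : 0 < w) (hw1 : w < 1) (hB : B ≠ 0) {T : ℕ} (hT : 1 ≤ T) {C : ℝ} (hC : 0 ≤ C)
    (hres : residual N τ κ x xhat q T ≤ C * T) :
    P.netCCV x T ≤ ((∑ i, m i : ℕ) * (n * (2 * √C) + n * (2 * √(C / (1 - κ)))
          + F₂ * (n * mixConst n B w * (2 * R))) + n * F₂ * mixConst n B w * (2 * R)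
        + ((∑ i, m i : ℕ) * F₂ * (n * √(K * τ 1) * √(√(K * τ 1))
            + n * mixConst n B w * (√(16 * n * √(2 * K) * C)
              + K * √(K * τ 1) * √(√(K * τ 1))) + √(16 * n * √(2 * K) * C))
          + n * F₂ * (mixConst n B w * (√(16 * n * √(2 * K) * C)
              + K * √(K * τ 1) * √(√(K * τ 1))) + 2 * (√(K * τ 1) * √(√(K * τ 1))))) + 0)
      * ((T : ℝ) ^ (1 - κ / 2) + (cumThreshold τ T * (T : ℝ) ^ 3) ^ (1 / 4 : ℝ) + 0) := by
  have hL : n * B ≠ 0 := Nat.mul_ne_zero hn.ne' hB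
  have hK := hτ.one_le
  have hc := mixConst_nonneg n B hw
  have hψ := hτ.cum_nonneg T
  set U := (cumThreshold τ T * (T : ℝ) ^ 3) ^ (1 / 4 : ℝ) with hU
  set V := (T : ℝ) ^ (1 - κ / 2) with hV
  set M : ℝ := ((∑ i, m i : ℕ) : ℝ) with hM
  set Z := totalStep N x xhat T with hZ
  set Δ := ∑ t ∈ Icc 1 T, disagreement xhat t with hΔ
  set S := √(K * τ 1) * √(√(K * τ 1)) with hS
  have hU0 : 0 ≤ U := by positivity
  have hV0 : 1 ≤ V := one_le_rpow_natCast hT (by linarith)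
  have hM0 : 0 ≤ M := by positivity
  have hψU : cumThreshold τ T ≤ S * U := by
    refine (hτ.cum_le_sqrt hT).trans ?_
    rw [hS, mul_assoc]
    exact mul_le_mul_of_nonneg_left (hτ.sqrt_cum_le_rpow hT) (Real.sqrt_nonneg _)
  have hZU : Z ≤ √(16 * n * √(2 * K) * C) * U := totalStep_le hτ hT hC hres
  set A := √(16 * n * √(2 * K) * C) with hA
  have hΔU : Δ ≤ mixConst n B w * (2 * R) * V + mixConst n B w * (A + K * S) * U := by
    have h1 := hr.sum_disagreement_le_totalStep hP hN hτ hκ.le hw hw1 hL hT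
    rw [← mixConst] at h1
    have h2 := mul_le_mul_of_nonneg_left (hτ.sqrt_cum_le_rpow hT)
      (show 0 ≤ K * √(K * τ 1) by positivity)
    have h3 := mul_le_mul_of_nonneg_left hV0 (show 0 ≤ 2 * R by positivity)
    have h4 : 2 * R + Z + K * √(K * τ 1) * √(cumThreshold τ T * T)
        ≤ 2 * R * V + (A + K * S) * U := by
      rw [hS]; linarith
    exact h1.trans ((mul_le_mul_of_nonneg_left h4 hc).trans (le_of_eq (by ring)))
  have hstep : ∑ i, ∑ t ∈ Icc 1 T, ‖x i t - x i (t + 1)‖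
      ≤ n * cumThreshold τ T + n * Δ + Z := by
    rw [Finset.sum_comm]
    exact hr.sum_norm_sub_succ_le hN hτ hκ.le T
  have hviol : ∑ i, ∑ t ∈ Icc 1 T, ‖plus (P.g i t (x i t))‖
      ≤ M * (n * (2 * √C * V) + n * (2 * √(C / (1 - κ)) * V)
        + F₂ * (n * cumThreshold τ T + n * Δ + Z)) := by
    calc ∑ i, ∑ t ∈ Icc 1 T, ‖plus (P.g i t (x i t))‖
        ≤ ∑ i, M * (2 * √C * V + 2 * √(C / (1 - κ)) * V
            + F₂ * ∑ t ∈ Icc 1 T, ‖x i t - x i (t + 1)‖) := by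
          refine Finset.sum_le_sum fun i _ => (hr.sum_norm_plus_le hP hκ1.le T i).trans ?_
          have hmi : (m i : ℝ) ≤ M := by
            rw [hM]
            exact_mod_cast Finset.single_le_sum (f := m) (fun _ _ => Nat.zero_le _)
              (Finset.mem_univ i)
          have h1 := norm_dual_mul_le hτ hκ.le hκ1.le hT hC hres i
          have h2 := sum_reg_mul_norm_dual_le hτ hκ.le hκ1 hT hC hres i
          have h3 : 0 ≤ ∑ t ∈ Icc 1 T, ‖x i t - x i (t + 1)‖ :=
            Finset.sum_nonneg fun _ _ => norm_nonneg _
          exact mul_le_mul hmi (by linarith)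
            (add_nonneg (add_nonneg (by positivity) (Finset.sum_nonneg fun t _ =>
              mul_nonneg (by unfold dualReg; positivity) (norm_nonneg _)))
              (mul_nonneg hF₂ h3)) hM0
      _ = M * (n * (2 * √C * V) + n * (2 * √(C / (1 - κ)) * V)
            + F₂ * ∑ i, ∑ t ∈ Icc 1 T, ‖x i t - x i (t + 1)‖) := by
          rw [← Finset.mul_sum, Finset.sum_add_distrib, ← Finset.mul_sum]
          simp only [Finset.sum_const, Finset.card_univ, Fintype.card_fin, nsmul_eq_mul]
          ring
      _ ≤ _ := by gcongr
  have hccv := hr.netCCV_le hP hτ hF₂ hκ.le hn T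
  have hk : 0 < 1 - κ := by linarith
  -- Only two rates occur here; the third slot is filled by zeros, which explains the `+ 0` in the
  -- statement.
  refine le_trans ?_ (weighted_sum_le (by positivity) (by positivity) le_rfl (by positivity) hU0
    le_rfl)
  have g1 : n * cumThreshold τ T + n * Δ + Z ≤ n * (S * U)
      + n * (mixConst n B w * (2 * R) * V + mixConst n B w * (A + K * S) * U) + A * U := by
    gcongr
  have g2 := mul_le_mul_of_nonneg_left g1 (mul_nonneg hM0 hF₂)
  have g3 := mul_le_mul_of_nonneg_left hΔU (show 0 ≤ n * F₂ by positivity)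
  have g4 := mul_le_mul_of_nonneg_left hψU (show 0 ≤ n * F₂ by positivity)
  have e : K * √(K * τ 1) * √(√(K * τ 1)) = K * S := by rw [hS]; ring
  have e' : n * √(K * τ 1) * √(√(K * τ 1)) = n * S := by rw [hS]; ring
  rw [e, e']
  linarith

end IsRun
end
end EventTriggered
end

open EventTriggered in
theorem theorem1 (n : ℕ) (hn : 0 < n) (m : Fin n → ℕ)
    (R F₁ F₂ : ℝ) (hR : 0 < R) (hF₁ : 0 < F₁) (hF₂ : 0 < F₂)
    (w : ℝ) (hw : w ∈ Set.Ioo (0 : ℝ) 1) (B : ℕ) (hB : 0 < B)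
    (κ : ℝ) (hκ : κ ∈ Set.Ioo (0 : ℝ) 1)
    (τ : ℕ → ℝ) (hτ_nonneg : ∀ t, 1 ≤ t → 0 ≤ τ t) (hτ_anti : ∀ t, 2 ≤ t → τ (t + 1) ≤ τ t)
    (hτ_one : 0 < τ 1) :
    ∃ C : ℝ, 0 < C ∧
      ∀ (p : ℕ) (P : Problem n p m) (N : Network n),
        P.Regular R F₁ F₂ → N.Regular w B →
      ∀ (x xhat : Fin n → ℕ → E p) (q : (i : Fin n) → ℕ → E (m i))
        (D : (i : Fin n) → ℕ → (E p →L[ℝ] E (m i))),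
        IsRun P N (fun t => √(cumThreshold τ t / t)) (fun t => 1 / (t : ℝ) ^ κ)
          (fun t => 1 / (t : ℝ) ^ (1 - κ)) τ x xhat q D →
      ∀ T : ℕ, 1 ≤ T → (P.staticFeasible T).Nonempty →
        (∀ y ∈ P.feasible T,
          P.netReg x y T ≤ C * ((T : ℝ) ^ κ + √(cumThreshold τ T * T)
            + √((cumThreshold τ T)⁻¹ * T) * pathLength y T)) ∧
        P.netCCV x T ≤ C * ((T : ℝ) ^ (1 - κ / 2)
            + (cumThreshold τ T * (T : ℝ) ^ 3) ^ (1 / 4 : ℝ)) := by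
  have hτ := quasiAntitone_of_antitone hτ_nonneg hτ_anti hτ_one
  obtain ⟨hw0, hw1⟩ := hw
  obtain ⟨hκ0, hκ1⟩ := hκ
  have hn' : (0 : ℝ) < n := by exact_mod_cast hn
  -- The constant is fixed before the dimension, problem, network and run are introduced, which
  -- gives its uniformity; its value is read off from `netReg_bound`.
  have h₀ : ∃ C₀ : ℝ, ∀ (p : ℕ) (P : Problem n p m) (N : Network n),
      P.Regular R F₁ F₂ → N.Regular w B →
      ∀ (x xhat : Fin n → ℕ → E p) (q : (i : Fin n) → ℕ → E (m i))
        (D : (i : Fin n) → ℕ → (E p →L[ℝ] E (m i))),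
        IsRun P N (stepSize τ) (dualReg κ) (dualStep κ) τ x xhat q D →
      ∀ T : ℕ, 1 ≤ T → ∀ y ∈ P.feasible T,
        n * P.netReg x y T ≤ C₀ * ((T : ℝ) ^ κ + √(cumThreshold τ T * T)
            + √((cumThreshold τ T)⁻¹ * T) * pathLength y T) :=
    ⟨_, fun p P N hP hN x xhat q D hr T hT y hy =>
      hr.netReg_bound hP hN hτ hn hR.le hF₂.le hκ0 hκ1 hw0 hw1 hB.ne' hT hy⟩
  have h₁ : ∃ C₁ : ℝ, ∀ (p : ℕ) (P : Problem n p m) (N : Network n),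
      P.Regular R F₁ F₂ → N.Regular w B →
      ∀ (x xhat : Fin n → ℕ → E p) (q : (i : Fin n) → ℕ → E (m i))
        (D : (i : Fin n) → ℕ → (E p →L[ℝ] E (m i))),
        IsRun P N (stepSize τ) (dualReg κ) (dualStep κ) τ x xhat q D →
      ∀ T : ℕ, 1 ≤ T → (P.staticFeasible T).Nonempty →
        P.netCCV x T ≤ C₁ * ((T : ℝ) ^ (1 - κ / 2)
            + (cumThreshold τ T * (T : ℝ) ^ 3) ^ (1 / 4 : ℝ) + 0) := by
    have hC := regretConst_nonneg n B (F₁ := F₁) hR.le hF₂.le hw0 hκ0 hτ_one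
      (zero_le_one.trans hτ.one_le)
    exact ⟨_, fun p P N hP hN x xhat q D hr T hT hfeas =>
      hr.netCCV_bound hP hN hτ hn hR.le hF₂.le hκ0 hκ1 hw0 hw1 hB.ne' hT (by positivity)
        (hr.residual_le hP hN hτ hn hR.le hF₂.le hκ0 hκ1 hw0 hw1 hB.ne' hT hfeas)⟩
  obtain ⟨C₀, h₀⟩ := h₀
  obtain ⟨C₁, h₁⟩ := h₁
  refine ⟨max 1 (max (C₀ / n) C₁), lt_max_of_lt_left one_pos,
    fun p P N hP hN x xhat q D hr T hT hfeas => ⟨fun y hy => ?_, ?_⟩⟩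
  -- The step sizes in the statement are by definition `stepSize τ`, `dualReg κ` and `dualStep κ`,
  -- so `hr` applies directly. The bound is for `n` times the regret, hence `C₀ / n`.
  · have h := h₀ p P N hP hN x xhat q D hr T hT y hy
    have hp := pathLength_nonneg y T
    rw [mul_comm, ← le_div_iff₀ hn', mul_div_right_comm] at h
    refine h.trans (mul_le_mul_of_nonneg_right ?_ (by positivity))
    exact (le_max_left _ _).trans (le_max_right _ _)
  · have h := h₁ p P N hP hN x xhat q D hr T hT hfeas
    rw [add_zero] at h
    have hψ := hτ.cum_nonneg T
    refine h.trans (mul_le_mul_of_nonneg_right ?_ (by positivity))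
    exact (le_max_right _ _).trans (le_max_right _ _)
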